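/- **The Cosmological Theorem (with $N = 29$).** A *string* is a finite sequence of integers (its letters). Conway's audioactive (look-and-say) operator is $$JHC(a_1^{m_1}a_2^{m_2}\cdots a_r^{m_r}) := m_1\,a_1\,m_2\,a_2\cdots m_r\,a_r ,$$ where $a^m$ means $a$ repeated $m\ge 1$ times, $a_i\neq a_{i+1}$, and each count $m_i$ is a single letter of the new string. A string $w$ that is the concatenation $L_1L_2\cdots L_k$ *splits* as $L_1.L_2.\cdots.L_k$ if $JHC^n(w)=JHC^n(L_1)\,JHC^n(L_2)\cdots JHC^n(L_k)$ (concatenation) for every $n\ge 0$. The *common* (stable) elements are the following 92 strings over $\{1,2,3\}$ (each digit is one letter): $\text{H}=22$, $\text{He}=13112221133211322112211213322112$, $\text{Li}=312211322212221121123222112$, $\text{Be}=111312211312113221133211322112211213322112$, $\text{B}=1321132122211322212221121123222112$, $\text{C}=3113112211322112211213322112$, $\text{N}=111312212221121123222112$, $\text{O}=132112211213322112$, $\text{F}=31121123222112$, $\text{Ne}=111213322112$, $\text{Na}=123222112$, $\text{Mg}=3113322112$, $\text{Al}=1113222112$, $\text{Si}=1322112$, $\text{P}=311311222112$, $\text{S}=1113122112$,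 $\text{Cl}=132112$, $\text{Ar}=3112$, $\text{K}=1112$, $\text{Ca}=12$, $\text{Sc}=3113112221133112$, $\text{Ti}=11131221131112$, $\text{V}=13211312$, $\text{Cr}=31132$, $\text{Mn}=111311222112$, $\text{Fe}=13122112$, $\text{Co}=32112$, $\text{Ni}=11133112$, $\text{Cu}=131112$, $\text{Zn}=312$, $\text{Ga}=13221133122211332$, $\text{Ge}=31131122211311122113222$, $\text{As}=11131221131211322113322112$, $\text{Se}=13211321222113222112$, $\text{Br}=3113112211322112$, $\text{Kr}=11131221222112$, $\text{Rb}=1321122112$, $\text{Sr}=3112112$, $\text{Y}=1112133$, $\text{Zr}=12322211331222113112211$, $\text{Nb}=1113122113322113111221131221$, $\text{Mo}=13211322211312113211$, $\text{Tc}=311322113212221$, $\text{Ru}=132211331222113112211$, $\text{Rh}=311311222113111221131221$, $\text{Pd}=111312211312113211$, $\text{Ag}=132113212221$, $\text{Cd}=3113112211$, $\text{In}=11131221$, $\text{Sn}=13211$, $\text{Sb}=3112221$, $\text{Te}=1322113312211$, $\text{I}=311311222113111221$, $\text{Xe}=11131221131211$, $\text{Cs}=13211321$, $\text{Ba}=311311$,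 $\text{La}=11131$, $\text{Ce}=1321133112$, $\text{Pr}=31131112$, $\text{Nd}=111312$, $\text{Pm}=132$, $\text{Sm}=311332$, $\text{Eu}=1113222$, $\text{Gd}=13221133112$, $\text{Tb}=3113112221131112$, $\text{Dy}=111312211312$, $\text{Ho}=1321132$, $\text{Er}=311311222$, $\text{Tm}=11131221133112$, $\text{Yb}=1321131112$, $\text{Lu}=311312$, $\text{Hf}=11132$, $\text{Ta}=13112221133211322112211213322113$, $\text{W}=312211322212221121123222113$, $\text{Re}=111312211312113221133211322112211213322113$, $\text{Os}=1321132122211322212221121123222113$, $\text{Ir}=3113112211322112211213322113$, $\text{Pt}=111312212221121123222113$, $\text{Au}=132112211213322113$, $\text{Hg}=31121123222113$, $\text{Tl}=111213322113$, $\text{Pb}=123222113$, $\text{Bi}=3113322113$, $\text{Po}=1113222113$, $\text{At}=1322113$, $\text{Rn}=311311222113$, $\text{Fr}=1113122113$, $\text{Ra}=132113$, $\text{Ac}=3113$, $\text{Th}=1113$, $\text{Pa}=13$, $\text{U}=3$. The *transuranic* elements are, for every integer $n\notin\{1,2,3\}$, the two strings $\text{Np}_n=1311222113321132211221121332211\,n$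 and $\text{Pu}_n=31221132221222112112322211\,n$, where the last letter is $n$ (for strings of positive integers only $n\ge 4$ can occur). A *compound* of common and transuranic elements is a string that splits as $L_1.L_2.\cdots.L_k$ where each $L_i$ is a common or a transuranic element. Theorem. Every non-empty finite string $w$ of integers decays in at most $29$ days into a compound of common and transuranic elements: for every $n\ge 29$, the string $JHC^n(w)$ is a compound of common and transuranic elements. -/

import Mathlib

/-- Run-length encoding: the list of pairs `(mᵢ, aᵢ)` such that the string is
`a₁ ^ m₁ a₂ ^ m₂ ⋯ aᵣ ^ mᵣ` with `mᵢ ≥ 1` and `aᵢ ≠ aᵢ₊₁`. -/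
def runs : List ℤ → List (ℕ × ℤ)
  | [] => []
  | a :: l =>
    match runs l with
    | [] => [(1, a)]
    | (m, b) :: t => if a = b then (m + 1, b) :: t else (1, a) :: (m, b) :: t

/-- Conway's audioactive (look-and-say) operator on strings of integers:
`a₁ ^ m₁ ⋯ aᵣ ^ mᵣ ↦ m₁ a₁ ⋯ mᵣ aᵣ`. Each `mᵢ` is a single letter of the new string. -/
def JHC (w : List ℤ) : List ℤ :=
  (runs w).flatMap fun p => [(p.1 : ℤ), p.2]

/-- The string `L₁ L₂ ⋯ Lₖ` splits as `L₁ . L₂ . ⋯ . Lₖ`: the parts never interact, that is,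
on every day its descendant is the concatenation of the descendants of the parts. -/
def SplitsAs (parts : List (List ℤ)) : Prop :=
  ∀ n : ℕ, JHC^[n] parts.flatten = (parts.map (JHC^[n])).flatten

/-- The 92 common (stable) elements, hydrogen to uranium. -/
def commonElements : List (List ℤ) :=
  [[2, 2], -- H
   [1, 3, 1, 1, 2, 2, 2, 1, 1, 3, 3, 2, 1, 1, 3, 2, 2, 1, 1, 2, 2, 1, 1, 2, 1, 3, 3, 2, 2, 1, 1, 2], -- He
   [3, 1, 2, 2, 1, 1, 3, 2, 2, 2, 1, 2, 2, 2, 1, 1, 2, 1, 1, 2, 3, 2, 2, 2, 1, 1, 2], -- Li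
   [1, 1, 1, 3, 1, 2, 2, 1, 1, 3, 1, 2, 1, 1, 3, 2, 2, 1, 1, 3, 3, 2, 1, 1, 3, 2, 2, 1, 1, 2, 2, 1, 1, 2, 1, 3, 3, 2, 2, 1, 1, 2], -- Be
   [1, 3, 2, 1, 1, 3, 2, 1, 2, 2, 2, 1, 1, 3, 2, 2, 2, 1, 2, 2, 2, 1, 1, 2, 1, 1, 2, 3, 2, 2, 2, 1, 1, 2], -- B
   [3, 1, 1, 3, 1, 1, 2, 2, 1, 1, 3, 2, 2, 1, 1, 2, 2, 1, 1, 2, 1, 3, 3, 2, 2, 1, 1, 2], -- C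
   [1, 1, 1, 3, 1, 2, 2, 1, 2, 2, 2, 1, 1, 2, 1, 1, 2, 3, 2, 2, 2, 1, 1, 2], -- N
   [1, 3, 2, 1, 1, 2, 2, 1, 1, 2, 1, 3, 3, 2, 2, 1, 1, 2], -- O
   [3, 1, 1, 2, 1, 1, 2, 3, 2, 2, 2, 1, 1, 2], -- F
   [1, 1, 1, 2, 1, 3, 3, 2, 2, 1, 1, 2], -- Ne
   [1, 2, 3, 2, 2, 2, 1, 1, 2], -- Na
   [3, 1, 1, 3, 3, 2, 2, 1, 1, 2], -- Mg
   [1, 1, 1, 3, 2, 2, 2, 1, 1, 2], -- Al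
   [1, 3, 2, 2, 1, 1, 2], -- Si
   [3, 1, 1, 3, 1, 1, 2, 2, 2, 1, 1, 2], -- P
   [1, 1, 1, 3, 1, 2, 2, 1, 1, 2], -- S
   [1, 3, 2, 1, 1, 2], -- Cl
   [3, 1, 1, 2], -- Ar
   [1, 1, 1, 2], -- K
   [1, 2], -- Ca
   [3, 1, 1, 3, 1, 1, 2, 2, 2, 1, 1, 3, 3, 1, 1, 2], -- Sc
   [1, 1, 1, 3, 1, 2, 2, 1, 1, 3, 1, 1, 1, 2], -- Ti
   [1, 3, 2, 1, 1, 3, 1, 2], -- V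
   [3, 1, 1, 3, 2], -- Cr
   [1, 1, 1, 3, 1, 1, 2, 2, 2, 1, 1, 2], -- Mn
   [1, 3, 1, 2, 2, 1, 1, 2], -- Fe
   [3, 2, 1, 1, 2], -- Co
   [1, 1, 1, 3, 3, 1, 1, 2], -- Ni
   [1, 3, 1, 1, 1, 2], -- Cu
   [3, 1, 2], -- Zn
   [1, 3, 2, 2, 1, 1, 3, 3, 1, 2, 2, 2, 1, 1, 3, 3, 2], -- Ga
   [3, 1, 1, 3, 1, 1, 2, 2, 2, 1, 1, 3, 1, 1, 1, 2, 2, 1, 1, 3, 2, 2, 2], -- Ge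
   [1, 1, 1, 3, 1, 2, 2, 1, 1, 3, 1, 2, 1, 1, 3, 2, 2, 1, 1, 3, 3, 2, 2, 1, 1, 2], -- As
   [1, 3, 2, 1, 1, 3, 2, 1, 2, 2, 2, 1, 1, 3, 2, 2, 2, 1, 1, 2], -- Se
   [3, 1, 1, 3, 1, 1, 2, 2, 1, 1, 3, 2, 2, 1, 1, 2], -- Br
   [1, 1, 1, 3, 1, 2, 2, 1, 2, 2, 2, 1, 1, 2], -- Kr
   [1, 3, 2, 1, 1, 2, 2, 1, 1, 2], -- Rb
   [3, 1, 1, 2, 1, 1, 2], -- Sr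
   [1, 1, 1, 2, 1, 3, 3], -- Y
   [1, 2, 3, 2, 2, 2, 1, 1, 3, 3, 1, 2, 2, 2, 1, 1, 3, 1, 1, 2, 2, 1, 1], -- Zr
   [1, 1, 1, 3, 1, 2, 2, 1, 1, 3, 3, 2, 2, 1, 1, 3, 1, 1, 1, 2, 2, 1, 1, 3, 1, 2, 2, 1], -- Nb
   [1, 3, 2, 1, 1, 3, 2, 2, 2, 1, 1, 3, 1, 2, 1, 1, 3, 2, 1, 1], -- Mo
   [3, 1, 1, 3, 2, 2, 1, 1, 3, 2, 1, 2, 2, 2, 1], -- Tc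
   [1, 3, 2, 2, 1, 1, 3, 3, 1, 2, 2, 2, 1, 1, 3, 1, 1, 2, 2, 1, 1], -- Ru
   [3, 1, 1, 3, 1, 1, 2, 2, 2, 1, 1, 3, 1, 1, 1, 2, 2, 1, 1, 3, 1, 2, 2, 1], -- Rh
   [1, 1, 1, 3, 1, 2, 2, 1, 1, 3, 1, 2, 1, 1, 3, 2, 1, 1], -- Pd
   [1, 3, 2, 1, 1, 3, 2, 1, 2, 2, 2, 1], -- Ag
   [3, 1, 1, 3, 1, 1, 2, 2, 1, 1], -- Cd
   [1, 1, 1, 3, 1, 2, 2, 1], -- In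
   [1, 3, 2, 1, 1], -- Sn
   [3, 1, 1, 2, 2, 2, 1], -- Sb
   [1, 3, 2, 2, 1, 1, 3, 3, 1, 2, 2, 1, 1], -- Te
   [3, 1, 1, 3, 1, 1, 2, 2, 2, 1, 1, 3, 1, 1, 1, 2, 2, 1], -- I
   [1, 1, 1, 3, 1, 2, 2, 1, 1, 3, 1, 2, 1, 1], -- Xe
   [1, 3, 2, 1, 1, 3, 2, 1], -- Cs
   [3, 1, 1, 3, 1, 1], -- Ba
   [1, 1, 1, 3, 1], -- La
   [1, 3, 2, 1, 1, 3, 3, 1, 1, 2], -- Ce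
   [3, 1, 1, 3, 1, 1, 1, 2], -- Pr
   [1, 1, 1, 3, 1, 2], -- Nd
   [1, 3, 2], -- Pm
   [3, 1, 1, 3, 3, 2], -- Sm
   [1, 1, 1, 3, 2, 2, 2], -- Eu
   [1, 3, 2, 2, 1, 1, 3, 3, 1, 1, 2], -- Gd
   [3, 1, 1, 3, 1, 1, 2, 2, 2, 1, 1, 3, 1, 1, 1, 2], -- Tb
   [1, 1, 1, 3, 1, 2, 2, 1, 1, 3, 1, 2], -- Dy
   [1, 3, 2, 1, 1, 3, 2], -- Ho
   [3, 1, 1, 3, 1, 1, 2, 2, 2], -- Er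
   [1, 1, 1, 3, 1, 2, 2, 1, 1, 3, 3, 1, 1, 2], -- Tm
   [1, 3, 2, 1, 1, 3, 1, 1, 1, 2], -- Yb
   [3, 1, 1, 3, 1, 2], -- Lu
   [1, 1, 1, 3, 2], -- Hf
   [1, 3, 1, 1, 2, 2, 2, 1, 1, 3, 3, 2, 1, 1, 3, 2, 2, 1, 1, 2, 2, 1, 1, 2, 1, 3, 3, 2, 2, 1, 1, 3], -- Ta
   [3, 1, 2, 2, 1, 1, 3, 2, 2, 2, 1, 2, 2, 2, 1, 1, 2, 1, 1, 2, 3, 2, 2, 2, 1, 1, 3], -- W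
   [1, 1, 1, 3, 1, 2, 2, 1, 1, 3, 1, 2, 1, 1, 3, 2, 2, 1, 1, 3, 3, 2, 1, 1, 3, 2, 2, 1, 1, 2, 2, 1, 1, 2, 1, 3, 3, 2, 2, 1, 1, 3], -- Re
   [1, 3, 2, 1, 1, 3, 2, 1, 2, 2, 2, 1, 1, 3, 2, 2, 2, 1, 2, 2, 2, 1, 1, 2, 1, 1, 2, 3, 2, 2, 2, 1, 1, 3], -- Os
   [3, 1, 1, 3, 1, 1, 2, 2, 1, 1, 3, 2, 2, 1, 1, 2, 2, 1, 1, 2, 1, 3, 3, 2, 2, 1, 1, 3], -- Ir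
   [1, 1, 1, 3, 1, 2, 2, 1, 2, 2, 2, 1, 1, 2, 1, 1, 2, 3, 2, 2, 2, 1, 1, 3], -- Pt
   [1, 3, 2, 1, 1, 2, 2, 1, 1, 2, 1, 3, 3, 2, 2, 1, 1, 3], -- Au
   [3, 1, 1, 2, 1, 1, 2, 3, 2, 2, 2, 1, 1, 3], -- Hg
   [1, 1, 1, 2, 1, 3, 3, 2, 2, 1, 1, 3], -- Tl
   [1, 2, 3, 2, 2, 2, 1, 1, 3], -- Pb
   [3, 1, 1, 3, 3, 2, 2, 1, 1, 3], -- Bi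
   [1, 1, 1, 3, 2, 2, 2, 1, 1, 3], -- Po
   [1, 3, 2, 2, 1, 1, 3], -- At
   [3, 1, 1, 3, 1, 1, 2, 2, 2, 1, 1, 3], -- Rn
   [1, 1, 1, 3, 1, 2, 2, 1, 1, 3], -- Fr
   [1, 3, 2, 1, 1, 3], -- Ra
   [3, 1, 1, 3], -- Ac
   [1, 1, 1, 3], -- Th
   [1, 3], -- Pa
   [3]] -- U

/-- The transuranic elements: the isotopes of neptunium and plutonium. There is one of each for
every letter `n` different from `1`, `2`, `3` (for strings of positive integers: `n ≥ 4`). -/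
def IsTransuranic (e : List ℤ) : Prop :=
  ∃ n : ℤ, n ≠ 1 ∧ n ≠ 2 ∧ n ≠ 3 ∧
    (e = [1, 3, 1, 1, 2, 2, 2, 1, 1, 3, 3, 2, 1, 1, 3, 2, 2, 1, 1, 2, 2, 1, 1, 2, 1, 3, 3, 2, 2, 1, 1, n] ∨
      e = [3, 1, 2, 2, 1, 1, 3, 2, 2, 2, 1, 2, 2, 2, 1, 1, 2, 1, 1, 2, 3, 2, 2, 2, 1, 1, n])

/-- A string is a compound of common and transuranic elements if it splits into such elements. -/
def IsCompound (w : List ℤ) : Prop :=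
  ∃ parts : List (List ℤ),
    w = parts.flatten ∧ SplitsAs parts ∧ ∀ e ∈ parts, e ∈ commonElements ∨ IsTransuranic e

/-! ### The look-and-say operator on concatenations -/

/-! The operator keeps the last letter of a word forever, so `u v` splits as `u . v` as soon as no
descendant of `v` starts with the last letter of `u`. Two sources of such `v` suffice. Some words
have first letters running through the cycle 1, 1, 3 and so never start with 2 (`StartsOddly.JHC`).
A word `22v`, with `v` empty or of that kind, starts with `22` forever (`neverStarts_of_two_two`).

After one day no letter occurs four times in a row, so from the second day on every count is 1, 2 or
3. Any other integer can then only be the second letter of a pair. What follows it starts with a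
count on every later day, so the word splits behind it (`exists_segments`). Every segment is a word
over 1, 2, 3, followed by at most one exotic letter `n`. The value of `n` plays no role and is
replaced by the placeholder 4, which makes the problem one about words over a finite alphabet.

Cutting at the recognized split points is a finite-state process when words are read from right to
left. Ten automata `table0`, ..., `table9` are given: the first accepts all segments, and each later
one accepts at least all pieces of the next day of the words accepted by its predecessor. Such an
inclusion is certified by a finite search through a product automaton
(`exists_isCutting_of_isNextDay`). The last automaton accepts only finitely many words, each of
which decays into elements within 18 days (`allAccepted_table9`). The elements decay into elements
(`elementWords_closed`), so compounds remain compounds. The total is 2 + 9 + 18 = 29 days. -/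

theorem runs_eq_nil {w : List ℤ} : runs w = [] ↔ w = [] := by
  cases w with
  | nil => simp [runs]
  | cons a l => simp only [runs]; split <;> (try split_ifs) <;> simp

theorem JHC_nil : JHC [] = [] := rfl

theorem JHC_eq_nil {w : List ℤ} : JHC w = [] ↔ w = [] := by
  conv_rhs => rw [← runs_eq_nil]
  rw [JHC]
  cases runs w <;> simp

theorem runs_head {w : List ℤ} {m : ℕ} {b : ℤ} {t : List (ℕ × ℤ)} (h : runs w = (m, b) :: t) :
    w.head? = some b := by
  cases w with
  | nil => simp [runs] at h
  | cons a l =>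
    simp only [runs] at h
    split at h
    · simp_all
    · split_ifs at h <;> simp_all

theorem runs_append {u v : List ℤ} (h : ∀ a, u.getLast? = some a → v.head? ≠ some a) :
    runs (u ++ v) = runs u ++ runs v := by
  induction u with
  | nil => simp [runs]
  | cons a l ih =>
    cases l with
    | nil =>
      have ha : v.head? ≠ some a := h a rfl
      simp only [List.cons_append, List.nil_append, runs]
      rcases hv : runs v with _ | ⟨⟨m, b⟩, t⟩
      · rfl
      · have : a ≠ b := by rintro rfl; exact ha (runs_head hv)
        simp [this]
    | cons b l =>
      have ih := ih fun x hx => h x (by simpa [List.getLast?_cons_cons] using hx)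
      rw [List.cons_append, runs, ih]
      conv_rhs => rw [runs]
      rcases hv : runs (b :: l) with _ | ⟨⟨m, c⟩, t⟩
      · exact absurd (runs_eq_nil.1 hv) (by simp)
      · simp only [List.cons_append]
        split_ifs <;> simp

theorem JHC_append {u v : List ℤ} (h : ∀ a, u.getLast? = some a → v.head? ≠ some a) :
    JHC (u ++ v) = JHC u ++ JHC v := by
  simp [JHC, runs_append h]

theorem runs_replicate_succ (m : ℕ) (a : ℤ) :
    runs (List.replicate (m + 1) a) = [(m + 1, a)] := by
  induction m with
  | zero => rfl
  | succ m ih => rw [List.replicate_succ, runs, ih]; simp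

theorem JHC_replicate_append {m : ℕ} (hm : 0 < m) {a : ℤ} {v : List ℤ} (h : v.head? ≠ some a) :
    JHC (List.replicate m a ++ v) = (m : ℤ) :: a :: JHC v := by
  obtain ⟨m, rfl⟩ := Nat.exists_eq_add_of_lt hm
  rw [JHC_append]
  · simp [JHC, runs_replicate_succ]
  · intro b hb
    simp [List.getLast?_replicate] at hb
    rwa [← hb]

/-- Induction on the runs of a word. -/
theorem List.runInduction {α : Type*} [DecidableEq α] {P : List α → Prop} (nil : P [])
    (append : ∀ (m : ℕ) (a : α) (v : List α), v.head? ≠ some a → P v →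
      P (List.replicate (m + 1) a ++ v)) (w : List α) : P w := by
  induction hn : w.length using Nat.strong_induction_on generalizing w with
  | _ n ih =>
    subst hn
    cases w with
    | nil => exact nil
    | cons a l =>
      have key : ∀ l : List α, ∃ m v, l = List.replicate m a ++ v ∧ v.head? ≠ some a := by
        intro l
        induction l with
        | nil => exact ⟨0, [], by simp⟩
        | cons b l ihl =>
          by_cases hb : b = a
          · obtain ⟨m, v, rfl, hv⟩ := ihl
            exact ⟨m + 1, v, by simp [hb, List.replicate_succ], hv⟩
          · exact ⟨0, b :: l, by simp, by simpa using hb⟩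
      obtain ⟨m, v, rfl, hv⟩ := key l
      exact append m a v hv (ih v.length (by simp only [List.length_cons, List.length_append]; omega) v rfl)

/-- The last run `a ^ m` becomes the pair `m a`. Hence the left side of a split enters only through
its last letter. -/
theorem JHC_getLast? (w : List ℤ) : (JHC w).getLast? = w.getLast? := by
  induction w using List.runInduction with
  | nil => rfl
  | append m a v hv ih =>
    rw [JHC_replicate_append m.succ_pos hv]
    rcases eq_or_ne v [] with rfl | hne
    · simp [JHC_nil, List.getLast?_replicate]
    · have h1 : JHC v ≠ [] := fun h => hne (JHC_eq_nil.1 h)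
      rw [List.getLast?_append, ← ih]
      cases hJ : JHC v with
      | nil => exact absurd hJ h1
      | cons x l =>
        rw [List.getLast?_cons_cons, List.getLast?_cons_cons]
        cases hx : (x :: l).getLast? with
        | none => simp at hx
        | some y => simp

theorem iterate_JHC_getLast? (n : ℕ) (w : List ℤ) : (JHC^[n] w).getLast? = w.getLast? := by
  induction n generalizing w with
  | zero => rfl
  | succ n ih => rw [Function.iterate_succ_apply, ih, JHC_getLast?]

theorem iterate_JHC_eq_nil {n : ℕ} {w : List ℤ} : JHC^[n] w = [] ↔ w = [] := by
  induction n generalizing w with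
  | zero => rfl
  | succ n ih => rw [Function.iterate_succ_apply, ih, JHC_eq_nil]

/-! ### Splitting -/

/-- No descendant of `w` (including `w`) starts with `a`. -/
def NeverStarts (a : ℤ) (w : List ℤ) : Prop :=
  ∀ n : ℕ, (JHC^[n] w).head? ≠ some a

/-- All descendants of `u` end in `a` and none of `v` starts with `a`, so no run ever crosses the
seam. -/
theorem NeverStarts.iterate_append {u v : List ℤ} {a : ℤ} (hu : u.getLast? = some a)
    (hv : NeverStarts a v) (n : ℕ) : JHC^[n] (u ++ v) = JHC^[n] u ++ JHC^[n] v := by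
  induction n with
  | zero => rfl
  | succ n ih =>
    simp only [Function.iterate_succ_apply', ih]
    refine JHC_append fun b hb => ?_
    rw [iterate_JHC_getLast?, hu] at hb
    cases hb
    exact hv n

theorem SplitsAs.nil : SplitsAs [] := fun n => by simp [iterate_JHC_eq_nil]

theorem SplitsAs.singleton (u : List ℤ) : SplitsAs [u] := fun n => by simp

theorem SplitsAs.cons {u : List ℤ} {ps : List (List ℤ)} {a : ℤ} (hu : u.getLast? = some a)
    (h : NeverStarts a ps.flatten) (hps : SplitsAs ps) : SplitsAs (u :: ps) := fun n => by
  rw [List.flatten_cons, h.iterate_append hu, hps n]; rfl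

/-- A non-empty part has non-empty descendants, so the first part alone determines the first letter
on every day. This makes splitting a condition on neighbouring parts. -/
theorem SplitsAs.neverStarts_flatten {v : List ℤ} {ps : List (List ℤ)} {a : ℤ}
    (h : SplitsAs (v :: ps)) (hv : v ≠ []) (ha : NeverStarts a v) :
    NeverStarts a (v :: ps).flatten := fun n => by
  rw [h n]
  have := ha n
  cases hJ : JHC^[n] v with
  | nil => exact absurd (iterate_JHC_eq_nil.1 hJ) hv
  | cons x l => rw [hJ] at this; simpa [hJ] using this

theorem SplitsAs.of_isChain {ps : List (List ℤ)} (hne : ∀ p ∈ ps, p ≠ [])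
    (h : ps.IsChain fun u v => ∃ a, u.getLast? = some a ∧ NeverStarts a v) : SplitsAs ps := by
  induction ps with
  | nil => exact .nil
  | cons u ps ih =>
    cases ps with
    | nil => exact .singleton u
    | cons v ps =>
      rw [List.isChain_cons_cons] at h
      obtain ⟨⟨a, hu, hv⟩, h⟩ := h
      have ih := ih (fun p hp => hne p (List.mem_cons_of_mem _ hp)) h
      exact ih.cons hu (ih.neverStarts_flatten (hne v (by simp)) hv)

/-- Refining each part of a splitting by its own splitting gives a splitting: the descendants agree
day by day. -/
theorem SplitsAs.isCompound_flatten {qs : List (List ℤ)} (h : SplitsAs qs)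
    (hq : ∀ q ∈ qs, IsCompound q) : IsCompound qs.flatten := by
  have key : ∀ qs : List (List ℤ), (∀ q ∈ qs, IsCompound q) → ∃ ps : List (List ℤ),
      qs.flatten = ps.flatten ∧
      (∀ n : ℕ, (qs.map (JHC^[n])).flatten = (ps.map (JHC^[n])).flatten) ∧
      ∀ e ∈ ps, e ∈ commonElements ∨ IsTransuranic e := by
    intro qs
    induction qs with
    | nil => intro _; exact ⟨[], by simp⟩
    | cons q qs ih =>
      intro hq
      obtain ⟨ps, h1, h2, h3⟩ := ih fun p hp => hq p (List.mem_cons_of_mem _ hp)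
      obtain ⟨rs, r1, r2, r3⟩ := hq q (by simp)
      refine ⟨rs ++ ps, by simp [h1, r1], fun n => ?_, fun e he => ?_⟩
      · rw [List.map_cons, List.flatten_cons, h2 n, r1, r2 n]; simp
      · rcases List.mem_append.1 he with he | he
        exacts [r3 e he, h3 e he]
  obtain ⟨ps, h1, h2, h3⟩ := key qs hq
  exact ⟨ps, h1, fun n => by rw [← h1, h n, h2 n], h3⟩

/-- The descendants of the parts on day `m` split again, because day `n` for them is day `n + m` for
the original parts. -/
theorem SplitsAs.isCompound_iterate {qs : List (List ℤ)} {m : ℕ} (h : SplitsAs qs)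
    (hq : ∀ q ∈ qs, IsCompound (JHC^[m] q)) : IsCompound (JHC^[m] qs.flatten) := by
  rw [h m]
  refine SplitsAs.isCompound_flatten (fun n => ?_) (by simpa using hq)
  rw [← h m, ← Function.iterate_add_apply, h (n + m), List.map_map]
  congr 2
  funext x
  simp [Function.iterate_add_apply]

/-! ### Words that never start with `2` -/

/-- The shapes of words over which the first letter runs through the cycle `1, 1, 3`. -/
inductive StartsOddly : List ℤ → Prop
  | three : StartsOddly [3]
  | big (a : ℤ) (h1 : a ≠ 1) (h2 : a ≠ 2) (h3 : a ≠ 3) : StartsOddly [a]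
  | three_run (m : ℕ) (a : ℤ) (v : List ℤ) (hm : m + 1 ≠ 3) (ha : a ≠ 3) (hv : v.head? ≠ some a) :
    StartsOddly (3 :: (List.replicate (m + 1) a ++ v))
  | one_single (a : ℤ) (v : List ℤ) (ha : a ≠ 1) (hv : v.head? ≠ some a) : StartsOddly (1 :: a :: v)
  | ones (v : List ℤ) (hv : v.head? ≠ some 1) : StartsOddly (1 :: 1 :: 1 :: v)

theorem JHC_cons {a : ℤ} {v : List ℤ} (h : v.head? ≠ some a) : JHC (a :: v) = 1 :: a :: JHC v :=
  JHC_replicate_append one_pos h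

theorem StartsOddly.head_ne {w : List ℤ} (h : StartsOddly w) : w.head? ≠ some 2 := by
  cases h <;> simp_all

/-- The shapes are passed through cyclically: `3 a^m ...` with `m ≠ 3` gives `1 3 m a ...`, then `1
a ...` with a single `a ≠ 1` gives `1 1 1 a ...`, and `1 1 1 ...` gives `3 1 ...`. The one-letter
words enter the cycle at `1 a`. -/
theorem StartsOddly.JHC {w : List ℤ} (h : StartsOddly w) : StartsOddly (JHC w) := by
  cases h with
  | three => exact one_single 3 [] (by decide) (by simp)
  | big a h1 h2 h3 => exact one_single a [] h1 (by simp)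
  | three_run m a v hm ha hv =>
    rw [JHC_cons (by simpa [List.replicate_succ] using ha), JHC_replicate_append m.succ_pos hv]
    exact one_single 3 _ (by decide)
      (by simp only [List.head?_cons, ne_eq, Option.some.injEq]; exact_mod_cast hm)
  | one_single a v ha hv =>
    rw [JHC_cons (by simpa using ha), JHC_cons hv]
    exact ones _ (by simpa using ha)
  | ones v hv =>
    have : _root_.JHC (1 :: 1 :: 1 :: v) = _ := JHC_replicate_append (m := 3) (by norm_num) hv
    rw [this]
    induction v using List.runInduction with
    | nil => exact three_run 0 1 [] (by decide) (by decide) (by simp)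
    | append m a v hva _ =>
      rw [JHC_replicate_append m.succ_pos hva]
      -- After `3 1` comes the next count. If it is 1, the run of ones has length exactly 2, since
      -- `a ≠ 1`; otherwise it has length 1. In neither case is it 3.
      rcases Nat.eq_zero_or_pos m with rfl | hm
      · exact three_run 1 1 (a :: _root_.JHC v) (by decide) (by decide) (by simpa using hv)
      · refine three_run 0 1 _ (by decide) (by decide) ?_
        simp only [List.head?_cons, ne_eq, Option.some.injEq]
        have : m + 1 ≠ 1 := by omega
        exact_mod_cast this

theorem StartsOddly.neverStarts {w : List ℤ} (h : StartsOddly w) : NeverStarts 2 w := fun n => by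
  have : StartsOddly (_root_.JHC^[n] w) := by
    induction n with
    | zero => exact h
    | succ n ih => rw [Function.iterate_succ_apply']; exact ih.JHC
  exact this.head_ne

/-- The block `22` reproduces itself, provided the rest never starts with 2 and so cannot lengthen
it. -/
theorem neverStarts_of_two_two {v : List ℤ} (h : v = [] ∨ StartsOddly v) {a : ℤ} (ha : a ≠ 2) :
    NeverStarts a (2 :: 2 :: v) := fun n => by
  have : ∃ u, JHC^[n] (2 :: 2 :: v) = 2 :: 2 :: u := by
    induction n generalizing v with
    | zero => exact ⟨v, rfl⟩
    | succ n ih =>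
      have h2 : v.head? ≠ some 2 := by
        rcases h with rfl | h
        exacts [by simp, h.head_ne]
      have : JHC (2 :: 2 :: v) = _ := JHC_replicate_append (m := 2) two_pos h2
      rw [Function.iterate_succ_apply, this]
      exact ih (h.imp JHC_eq_nil.2 StartsOddly.JHC)
  obtain ⟨u, hu⟩ := this
  rw [hu]
  simpa using ha.symm

/-! ### Words over the letters `1, 2, 3` and a placeholder `4` for all other integers -/

/-- The letters used in the finite computations; `4` stands for an integer outside `{1, 2, 3}`. -/
def IsLetter (a : ℕ) : Prop := 1 ≤ a ∧ a ≤ 4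

/-- The value of a letter when `4` stands for `n`. -/
def letterValue (n : ℤ) (a : ℕ) : ℤ := if a = 4 then n else a

/-- The integer string denoted by a word when `4` stands for `n`. -/
def interp (n : ℤ) (w : List ℕ) : List ℤ := w.map (letterValue n)

/-- No letter occurs four times in a row. -/
def NoFour {α : Type*} (w : List α) : Prop := ∀ a, ¬ [a, a, a, a] <:+: w

theorem NoFour.infix {α : Type*} {u w : List α} (h : NoFour w) (hu : u <:+: w) : NoFour u :=
  fun a ha => h a (ha.trans hu)

/-- An integer that is not one of the three common letters. -/
def IsExotic (n : ℤ) : Prop := n ≠ 1 ∧ n ≠ 2 ∧ n ≠ 3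

theorem letterValue_injOn {n : ℤ} (hn : IsExotic n) {a b : ℕ} (ha : IsLetter a) (hb : IsLetter b)
    (h : letterValue n a = letterValue n b) : a = b := by
  obtain ⟨h1, h2, h3⟩ := hn
  obtain ⟨ha, ha'⟩ := ha
  obtain ⟨hb, hb'⟩ := hb
  unfold letterValue at h
  split_ifs at h <;> omega

theorem letterValue_of_le {n : ℤ} {a : ℕ} (h : a ≤ 3) : letterValue n a = a :=
  if_neg (by omega)

theorem interp_head?_ne {n : ℤ} (hn : IsExotic n) {w : List ℕ} (hw : ∀ a ∈ w, IsLetter a) {a : ℕ}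
    (ha : IsLetter a) (h : w.head? ≠ some a) : (interp n w).head? ≠ some (letterValue n a) := by
  cases w with
  | nil => simp [interp]
  | cons b w =>
    simp only [interp, List.map_cons, List.head?_cons, ne_eq, Option.some.injEq] at h ⊢
    exact fun e => h (letterValue_injOn hn (hw b (by simp)) ha e)

/-- The functions evaluated in the finite checks use `Nat.beq`, `Nat.ble` and `bif`, which compute
directly on numerals. This lemma and the next lead back to propositions. -/
theorem Nat.beq_eq_decide_eq (a b : ℕ) : Nat.beq a b = decide (a = b) := by
  rw [Bool.eq_iff_iff]; simp

theorem Nat.ble_eq_decide_le (a b : ℕ) : Nat.ble a b = decide (a ≤ b) := by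
  rw [Bool.eq_iff_iff]; simp

/-! ### Look-and-say on words -/

/-- A new letter on the left lengthens the first run or opens another one. The default case arises
only for the empty word, since `look` never yields a single letter (`look_shape`). -/
def lookCons (a : ℕ) : List ℕ → List ℕ
  | m :: b :: v => bif Nat.beq a b then m.succ :: b :: v else 1 :: a :: m :: b :: v
  | _ => [1, a]

/-- The look-and-say operator on words. -/
def look : List ℕ → List ℕ
  | [] => []
  | a :: w => lookCons a (look w)

theorem look_shape (w : List ℕ) :
    (w = [] ∧ look w = []) ∨ ∃ m b v, look w = m :: b :: v ∧ w.head? = some b := by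
  cases w with
  | nil => exact .inl ⟨rfl, rfl⟩
  | cons a w =>
    right
    rw [look]
    unfold lookCons
    split
    · rename_i m b v _
      rcases eq_or_ne a b with rfl | h
      · exact ⟨m + 1, a, v, by simp, rfl⟩
      · exact ⟨1, a, m :: b :: v, by simp [Nat.beq_eq_decide_eq, h], rfl⟩
    · exact ⟨1, a, [], rfl, rfl⟩

theorem look_cons {a : ℕ} {w : List ℕ} (h : w.head? ≠ some a) : look (a :: w) = 1 :: a :: look w := by
  rw [look]
  rcases look_shape w with ⟨-, hw⟩ | ⟨m, b, v, hw, hb⟩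
  · rw [hw]; rfl
  · have : a ≠ b := by rintro rfl; exact h hb
    rw [hw]
    simp [lookCons, Nat.beq_eq_decide_eq, this]

theorem look_replicate_append (m : ℕ) {a : ℕ} {w : List ℕ} (h : w.head? ≠ some a) :
    look (List.replicate (m + 1) a ++ w) = (m + 1) :: a :: look w := by
  induction m with
  | zero => exact look_cons h
  | succ m ih => rw [List.replicate_succ, List.cons_append, look, ih]; simp [lookCons]

theorem NoFour.run_le {α : Type*} {m : ℕ} {a : α} {w : List α}
    (h : NoFour (List.replicate (m + 1) a ++ w)) : m + 1 ≤ 3 := by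
  by_contra hm
  obtain ⟨k, rfl⟩ : ∃ k, m = k + 3 := ⟨m - 3, by omega⟩
  exact h a ⟨[], List.replicate k a ++ w, by simp [List.replicate_succ, Nat.add_assoc]⟩

/-- Exoticness of `n` keeps different letters different, so the runs correspond. `NoFour` keeps the
counts below 4, so that no count is mistaken for the placeholder. -/
theorem JHC_interp {n : ℤ} (hn : IsExotic n) {w : List ℕ} (hw : ∀ a ∈ w, IsLetter a)
    (h4 : NoFour w) : JHC (interp n w) = interp n (look w) := by
  induction w using List.runInduction with
  | nil => rfl
  | append m a v hv ih =>
    have hm := h4.run_le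
    have ha : IsLetter a := hw a (by simp)
    have hv' : ∀ b ∈ v, IsLetter b := fun b hb => hw b (by simp [hb])
    rw [look_replicate_append m hv]
    have : interp n (List.replicate (m + 1) a ++ v) =
        List.replicate (m + 1) (letterValue n a) ++ interp n v := by simp [interp]
    rw [this, JHC_replicate_append m.succ_pos (interp_head?_ne hn hv' ha hv),
      ih hv' (h4.infix (List.suffix_append _ _).isInfix)]
    simp [interp, letterValue_of_le hm]

theorem look_letters {w : List ℕ} (hw : ∀ a ∈ w, IsLetter a) (h4 : NoFour w) :
    ∀ a ∈ look w, IsLetter a := by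
  induction w using List.runInduction with
  | nil => exact hw
  | append m a v hv ih =>
    have hm := h4.run_le
    rw [look_replicate_append m hv]
    have ih := ih (fun b hb => hw b (by simp [hb])) (h4.infix (List.suffix_append _ _).isInfix)
    intro b hb
    rcases List.mem_cons.1 hb with rfl | hb
    · exact ⟨by omega, by omega⟩
    rcases List.mem_cons.1 hb with rfl | hb
    · exact hw b (by simp)
    · exact ih b hb

/-- A word of pairs `m a` with changing second letters has no letter four times in a row. -/
theorem noFour_cons_cons {α : Type*} {m a : α} {v : List α} (hv : NoFour v)
    (h : v = [] ∨ ∃ k b t, v = k :: b :: t ∧ b ≠ a) : NoFour (m :: a :: v) := by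
  intro x hx
  rw [List.infix_cons_iff, List.infix_cons_iff] at hx
  rcases h with rfl | ⟨k, b, t, rfl, hb⟩
  · simp at hx
  · rcases hx with hx | hx | hx
    · simp only [List.cons_prefix_cons] at hx
      exact hb (hx.2.2.2.1.symm.trans hx.2.1)
    · simp only [List.cons_prefix_cons] at hx
      exact hb (hx.2.2.1.symm.trans hx.1)
    · exact hv x hx

theorem noFour_look (w : List ℕ) : NoFour (look w) := by
  induction w using List.runInduction with
  | nil => intro a h; simp [look] at h
  | append m a v hv ih =>
    rw [look_replicate_append m hv]
    refine noFour_cons_cons ih ?_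
    rcases look_shape v with ⟨-, h⟩ | ⟨k, b, t, h, hb⟩
    · exact .inl h
    · exact .inr ⟨k, b, t, h, fun e => hv (e ▸ hb)⟩

/-! ### Recognizing split points -/

/-- What is remembered of a word read from right to left: its first letter (`0` for the empty word),
the length of its first run (at most `4`), and a flag. If the first letter is not `2`, the flag
guarantees that no descendant starts with `2`; if it is `2`, the flag guarantees the same of the
word without its first run, or that nothing is left of it. -/
structure StartClass where
  head : ℕ
  length : ℕ
  flag : Bool

def emptyClass : StartClass := ⟨0, 0, true⟩

/-- The start class of `c :: w`, given that of `w`. -/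
def StartClass.cons (c : ℕ) : StartClass → StartClass
  | ⟨h, l, f⟩ =>
    -- The flags follow the constructors of `StartsOddly`: `111` exactly; a 1 before a run of length
    -- 1; a 3 not before a run of length 3 (length 0 covers the word `3`); a 4 with nothing after
    -- it. A leading 2 passes on the flag of what follows its run. Lengths are capped at 4 because
    -- only the values up to 3 are ever distinguished.
    bif Nat.beq c 1 then
      bif Nat.beq h 1 then ⟨1, bif Nat.ble 4 l then 4 else l.succ, Nat.beq l 2⟩ else ⟨1, 1, Nat.beq l 1⟩
    else bif Nat.beq c 2 then
      bif Nat.beq h 2 then ⟨2, bif Nat.ble 4 l then 4 else l.succ, f⟩ else ⟨2, 1, f⟩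
    else bif Nat.beq c 3 then
      bif Nat.beq h 3 then ⟨3, bif Nat.ble 4 l then 4 else l.succ, false⟩ else ⟨3, 1, not (Nat.beq l 3)⟩
    else
      bif Nat.beq h 4 then ⟨4, bif Nat.ble 4 l then 4 else l.succ, false⟩ else ⟨4, 1, Nat.beq h 0⟩

/-- Whether there is a recognized split point between the letter `c` and a word with this class. -/
def StartClass.splits (c : ℕ) : StartClass → Bool
  | ⟨h, l, f⟩ =>
    bif Nat.beq h 0 then false
    else bif Nat.beq c 4 then false
    -- Behind a 2 the right side must never start with 2; behind a 1 or 3 it must start with exactly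
    -- two 2s, with nothing or a cyclic shape after them.
    else bif Nat.beq c 2 then and (not (Nat.beq h 2)) f
    else and (Nat.beq h 2) (and (Nat.beq l 2) f)

def startClass (w : List ℕ) : StartClass := w.foldr StartClass.cons emptyClass

/-- The meaning of the data in a start class. -/
def StartClass.Describes (n : ℤ) (k : StartClass) (u : List ℕ) : Prop :=
  (u = [] ∧ k = emptyClass) ∨ ∃ l v, u = List.replicate (l + 1) k.head ++ v ∧
    v.head? ≠ some k.head ∧ k.length = min (l + 1) 4 ∧ (k.flag = true →
      if k.head = 2 then v = [] ∨ StartsOddly (interp n v) else StartsOddly (interp n u))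

theorem StartClass.Describes.cons {n : ℤ} (hn : IsExotic n) {k : StartClass} {u : List ℕ} {c : ℕ}
    (hu : ∀ a ∈ u, IsLetter a) (hc : IsLetter c) (h : k.Describes n u) :
    (k.cons c).Describes n (c :: u) := by
  obtain ⟨hd, len, fl⟩ := k
  have ⟨hn1, hn2, hn3⟩ := hn
  have hc' : c = 1 ∨ c = 2 ∨ c = 3 ∨ c = 4 := by have := hc.1; have := hc.2; omega
  right
  rcases h with ⟨rfl, h⟩ | ⟨l, v, rfl, hv, hl, hf⟩
  · cases h
    refine ⟨0, [], ?_⟩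
    rcases hc' with rfl | rfl | rfl | rfl
    · simp [StartClass.cons, Nat.beq_eq_decide_eq]
    · simp [StartClass.cons, Nat.beq_eq_decide_eq]
    · simpa [StartClass.cons, Nat.beq_eq_decide_eq, interp, letterValue] using StartsOddly.three
    · simpa [StartClass.cons, Nat.beq_eq_decide_eq, interp, letterValue] using
        StartsOddly.big n hn1 hn2 hn3
  · simp only at hv hl hf hu
    have hhd : IsLetter hd := hu hd (by simp)
    have hv' := interp_head?_ne hn (fun a ha => hu a (by simp [ha])) hhd hv
    by_cases hch : c = hd
    · subst hch
      have hmin : (if 4 ≤ len then 4 else len + 1) = min (l + 2) 4 := by split_ifs <;> omega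
      refine ⟨l + 1, v, ?_⟩
      rcases hc' with rfl | rfl | rfl | rfl
      · simp only [StartClass.cons, Nat.beq_eq_decide_eq, Nat.ble_eq_decide_le, decide_true, cond_true,
          Bool.cond_decide, decide_eq_true_eq]
        refine ⟨by simp [List.replicate_succ], hv, hmin, fun h => ?_⟩
        obtain rfl : l = 1 := by omega
        simpa [interp, letterValue, List.replicate_succ] using StartsOddly.ones _ hv'
      · simp only [StartClass.cons, Nat.beq_eq_decide_eq, Nat.ble_eq_decide_le, decide_true, cond_true,
          Bool.cond_decide]
        exact ⟨by simp [List.replicate_succ], hv, by simpa using hmin, hf⟩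
      · simp only [StartClass.cons, Nat.beq_eq_decide_eq, Nat.ble_eq_decide_le, decide_true, cond_true,
          Bool.cond_decide]
        exact ⟨by simp [List.replicate_succ], hv, by simpa using hmin, by simp⟩
      · simp only [StartClass.cons, Nat.beq_eq_decide_eq, Nat.ble_eq_decide_le, decide_true, cond_true,
          Bool.cond_decide]
        exact ⟨by simp [List.replicate_succ], hv, by simpa using hmin, by simp⟩
    · have hcv : letterValue n c ≠ letterValue n hd := fun h => hch (letterValue_injOn hn hc hhd h)
      have hhc : ¬ hd = c := fun h => hch h.symm
      refine ⟨0, List.replicate (l + 1) hd ++ v, ?_⟩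
      rcases hc' with rfl | rfl | rfl | rfl
      · simp only [StartClass.cons, Nat.beq_eq_decide_eq, hhc, decide_true, decide_false, cond_true,
          cond_false, decide_eq_true_eq]
        refine ⟨by simp, by simpa [List.replicate_succ] using hhc, by simp, fun h => ?_⟩
        obtain rfl : l = 0 := by omega
        simpa [interp, letterValue] using StartsOddly.one_single _ _ hcv.symm hv'
      · simp only [StartClass.cons, Nat.beq_eq_decide_eq, hhc, decide_true, decide_false, cond_true,
          cond_false]
        refine ⟨by simp, by simpa [List.replicate_succ] using hhc, by simp, fun h => ?_⟩
        have := hf h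
        rw [if_neg hhc] at this
        exact (if_pos rfl).symm ▸ .inr this
      · simp only [StartClass.cons, Nat.beq_eq_decide_eq, hhc, decide_true, decide_false, cond_true,
          cond_false]
        refine ⟨by simp, by simpa [List.replicate_succ] using hhc, by simp, fun h => ?_⟩
        have hl3 : l + 1 ≠ 3 := by
          rintro h3
          simp [show len = 3 by omega] at h
        simpa [interp, letterValue] using StartsOddly.three_run l _ _ hl3 hcv.symm hv'
      · have hhd0 : ¬ hd = 0 := by have := hhd.1; omega
        simp only [StartClass.cons, Nat.beq_eq_decide_eq, hhc, hhd0, decide_false, cond_false]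
        exact ⟨by simp, by simpa [List.replicate_succ] using hhc, by simp, by simp⟩

theorem startClass_describes {n : ℤ} (hn : IsExotic n) {u : List ℕ} (hu : ∀ a ∈ u, IsLetter a) :
    (startClass u).Describes n u := by
  induction u with
  | nil => exact .inl ⟨rfl, rfl⟩
  | cons c u ih =>
    have hu' : ∀ a ∈ u, IsLetter a := fun a ha => hu a (by simp [ha])
    exact (ih hu').cons hn hu' (hu c (by simp))

theorem neverStarts_of_splits {n : ℤ} (hn : IsExotic n) {u : List ℕ} (hu : ∀ a ∈ u, IsLetter a)
    {c : ℕ} (hc : IsLetter c) (h : (startClass u).splits c = true) :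
    NeverStarts (letterValue n c) (interp n u) := by
  have hd := startClass_describes hn hu
  generalize startClass u = k at h hd
  obtain ⟨hd', len, fl⟩ := k
  simp only [StartClass.splits, Nat.beq_eq_decide_eq, Bool.cond_decide] at h
  split_ifs at h with h0 h4 h2
  rcases hd with ⟨rfl, hk⟩ | ⟨l, v, rfl, hv, hl, hf⟩
  · cases hk; exact absurd rfl h0
  · simp only [Bool.and_eq_true, Bool.not_eq_true', decide_eq_false_iff_not] at h
    have := hf h.2
    rw [if_neg h.1] at this
    subst h2
    simpa [letterValue] using this.neverStarts
  · rcases hd with ⟨rfl, hk⟩ | ⟨l, v, rfl, hv, hl, hf⟩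
    · cases hk; exact absurd rfl h0
    · simp only [Bool.and_eq_true, decide_eq_true_eq] at h
      obtain ⟨h1, h3, h4'⟩ := h
      simp only at hl hf
      have := hf h4'
      rw [if_pos h1] at this
      subst h1
      obtain rfl : l = 1 := by omega
      have hc2 : letterValue n c ≠ 2 := by
        intro h
        exact h2 (letterValue_injOn hn hc ⟨by omega, by omega⟩ (h.trans (by simp [letterValue])))
      refine neverStarts_of_two_two (v := interp n v) ?_ hc2
      rcases this with rfl | h
      exacts [.inl rfl, .inr h]

/-! ### Cutting a word into pieces that split -/

/-- `ps` is a factorization of `w` into non-empty pieces, each cut being a recognized split point. -/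
structure IsCutting (ps : List (List ℕ)) (w : List ℕ) : Prop where
  flatten_eq : ps.flatten = w
  ne_nil : ∀ p ∈ ps, p ≠ []
  isChain : ps.IsChain fun u v => ∃ c, u.getLast? = some c ∧ (startClass v).splits c = true

theorem IsCutting.nil : IsCutting [] [] := ⟨rfl, by simp, .nil⟩

theorem IsCutting.singleton (c : ℕ) : IsCutting [[c]] [c] := ⟨rfl, by simp, .singleton _⟩

theorem IsCutting.extend {u w : List ℕ} {ps : List (List ℕ)} (h : IsCutting (u :: ps) w) (c : ℕ) :
    IsCutting ((c :: u) :: ps) (c :: w) where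
  flatten_eq := by rw [← h.flatten_eq]; rfl
  ne_nil p hp := by
    rcases List.mem_cons.1 hp with rfl | hp
    exacts [by simp, h.ne_nil p (by simp [hp])]
  isChain := by
    obtain ⟨d, u, rfl⟩ := List.exists_cons_of_ne_nil (h.ne_nil u (by simp))
    have := h.isChain
    cases ps with
    | nil => exact .singleton _
    | cons v ps =>
      rw [List.isChain_cons_cons] at this ⊢
      exact ⟨by simpa only [List.getLast?_cons_cons] using this.1, this.2⟩

theorem IsCutting.split {u w : List ℕ} {ps : List (List ℕ)} (h : IsCutting (u :: ps) w) {c : ℕ}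
    (hc : (startClass u).splits c = true) : IsCutting ([c] :: u :: ps) (c :: w) where
  flatten_eq := by rw [← h.flatten_eq]; rfl
  ne_nil p hp := by
    rcases List.mem_cons.1 hp with rfl | hp
    exacts [by simp, h.ne_nil p hp]
  isChain := List.isChain_cons_cons.2 ⟨⟨c, rfl, hc⟩, h.isChain⟩

theorem IsCutting.mem_isInfix {ps : List (List ℕ)} {w : List ℕ} (h : IsCutting ps w) {p : List ℕ}
    (hp : p ∈ ps) : p <:+: w := by
  obtain ⟨s, t, rfl⟩ := List.append_of_mem hp
  exact ⟨s.flatten, t.flatten, by simp [← h.flatten_eq]⟩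

theorem IsCutting.splitsAs {n : ℤ} (hn : IsExotic n) {ps : List (List ℕ)} {w : List ℕ}
    (h : IsCutting ps w) (hw : ∀ a ∈ w, IsLetter a) : SplitsAs (ps.map (interp n)) := by
  refine .of_isChain ?_ ?_
  · intro p hp
    obtain ⟨u, hu, rfl⟩ := List.mem_map.1 hp
    simpa [interp] using h.ne_nil u hu
  · have hl : ∀ p ∈ ps, ∀ a ∈ p, IsLetter a := fun p hp a ha =>
      hw a ((h.mem_isInfix hp).subset ha)
    rw [List.isChain_map]
    refine (List.isChain_iff_forall_rel_of_append_cons_cons).2 ?_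
    intro u v l₁ l₂ hps
    obtain ⟨c, hc, hs⟩ := (List.isChain_iff_forall_rel_of_append_cons_cons).1 h.isChain hps
    have hcu : IsLetter c := hl u (by simp [hps]) c (List.mem_of_getLast? hc)
    exact ⟨letterValue n c, by simp [interp, hc], neverStarts_of_splits hn (hl v (by simp [hps])) hcu hs⟩

/-- If all pieces of the next day become compounds after `m` days, so does the word after `m + 1`. -/
theorem IsCutting.isCompound {n : ℤ} (hn : IsExotic n) {ps : List (List ℕ)} {w : List ℕ}
    (h : IsCutting ps (look w)) (hw : ∀ a ∈ w, IsLetter a) (h4 : NoFour w) {m : ℕ}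
    (hps : ∀ p ∈ ps, IsCompound (JHC^[m] (interp n p))) :
    IsCompound (JHC^[m + 1] (interp n w)) := by
  rw [Function.iterate_succ_apply, JHC_interp hn hw h4, ← h.flatten_eq]
  have : interp n ps.flatten = (ps.map (interp n)).flatten := by simp [interp, List.map_flatten]; rfl
  rw [this]
  exact (h.splitsAs hn (look_letters hw h4)).isCompound_iterate (by simpa using hps)

/-- The class recorded is that of the current piece only, not of the whole remaining word. This
suffices by `SplitsAs.neverStarts_flatten`, and it makes the pieces computable by a finite
automaton. -/
def cutCons (c : ℕ) : StartClass × List (List ℕ) → StartClass × List (List ℕ)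
  | (k, u :: ps) =>
    bif k.splits c then (emptyClass.cons c, [c] :: u :: ps) else (k.cons c, (c :: u) :: ps)
  | (_, []) => (emptyClass.cons c, [[c]])

/-- The pieces of a word, with the start class of the first one. -/
def cut : List ℕ → StartClass × List (List ℕ)
  | [] => (emptyClass, [])
  | c :: w => cutCons c (cut w)

theorem cut_spec (w : List ℕ) :
    IsCutting (cut w).2 w ∧ (cut w).1 = startClass ((cut w).2.headD []) := by
  induction w with
  | nil => exact ⟨.nil, rfl⟩
  | cons c w ih =>
    rw [cut]
    generalize cut w = x at ih
    obtain ⟨k, _ | ⟨u, ps⟩⟩ := x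
    · obtain rfl : [] = w := ih.1.flatten_eq
      exact ⟨.singleton c, rfl⟩
    · obtain ⟨h, hk⟩ := ih
      simp only [List.headD_cons] at hk h
      subst hk
      rcases hs : (startClass u).splits c with _ | _
      · simp only [cutCons, hs, cond_false]
        exact ⟨h.extend c, rfl⟩
      · simp only [cutCons, hs, cond_true]
        exact ⟨h.split hs, rfl⟩

/-! ### Elements -/

/-- The number with the given decimal digits. -/
def wordCode (w : List ℕ) : ℕ := w.foldl (fun m a => Nat.add (Nat.mul 10 m) a) 0

/-- Letters lie between 1 and 4, so there are neither carries nor leading zeros. -/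
theorem wordCode_injOn {u v : List ℕ} (hu : ∀ a ∈ u, IsLetter a) (hv : ∀ a ∈ v, IsLetter a)
    (h : wordCode u = wordCode v) : u = v := by
  have key : ∀ (w : List ℕ) (a : ℕ), wordCode (w ++ [a]) = 10 * wordCode w + a := fun w a => by
    simp [wordCode]
  induction u using List.reverseRecOn generalizing v with
  | nil =>
    rcases List.eq_nil_or_concat' v with rfl | ⟨w, b, rfl⟩
    · rfl
    · have := (hv b (by simp)).1
      rw [key] at h
      change 0 = _ at h
      omega
  | append_singleton u a ih =>
    have ha := hu a (by simp)
    rcases List.eq_nil_or_concat' v with rfl | ⟨w, b, rfl⟩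
    · rw [key] at h
      change _ = 0 at h
      have := ha.1
      omega
    · have hb := hv b (by simp)
      rw [key, key] at h
      obtain ⟨⟨h1, h2⟩, h3, h4⟩ := And.intro ha hb
      rw [ih (v := w) (fun x hx => hu x (by simp [hx])) (fun x hx => hv x (by simp [hx])) (by omega),
        show a = b by omega]

/-- The elements, with `4` for the last letter of the two transuranic ones. -/
def elementWords : List (List ℕ) :=
  commonElements.map (List.map Int.toNat) ++
    [[1, 3, 1, 1, 2, 2, 2, 1, 1, 3, 3, 2, 1, 1, 3, 2, 2, 1, 1, 2, 2, 1, 1, 2, 1, 3, 3, 2, 2, 1, 1, 4],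
      [3, 1, 2, 2, 1, 1, 3, 2, 2, 2, 1, 2, 2, 2, 1, 1, 2, 1, 1, 2, 3, 2, 2, 2, 1, 1, 4]]

def elementCodes : List ℕ :=
  [22, 13112221133211322112211213322112, 312211322212221121123222112,
    111312211312113221133211322112211213322112, 1321132122211322212221121123222112,
    3113112211322112211213322112, 111312212221121123222112, 132112211213322112, 31121123222112,
    111213322112, 123222112, 3113322112, 1113222112, 1322112, 311311222112, 1113122112, 132112,
    3112, 1112, 12, 3113112221133112, 11131221131112, 13211312, 31132, 111311222112, 13122112,
    32112, 11133112, 131112, 312, 13221133122211332, 31131122211311122113222,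
    11131221131211322113322112, 13211321222113222112, 3113112211322112, 11131221222112,
    1321122112, 3112112, 1112133, 12322211331222113112211, 1113122113322113111221131221,
    13211322211312113211, 311322113212221, 132211331222113112211, 311311222113111221131221,
    111312211312113211, 132113212221, 3113112211, 11131221, 13211, 3112221, 1322113312211,
    311311222113111221, 11131221131211, 13211321, 311311, 11131, 1321133112, 31131112, 111312,
    132, 311332, 1113222, 13221133112, 3113112221131112, 111312211312, 1321132, 311311222,
    11131221133112, 1321131112, 311312, 11132, 13112221133211322112211213322113,
    312211322212221121123222113, 111312211312113221133211322112211213322113,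
    1321132122211322212221121123222113, 3113112211322112211213322113, 111312212221121123222113,
    132112211213322113, 31121123222113, 111213322113, 123222113, 3113322113, 1113222113, 1322113,
    311311222113, 1113122113, 132113, 3113, 1113, 13, 3, 13112221133211322112211213322114,
    312211322212221121123222114]

theorem elementCodes_eq : elementCodes = elementWords.map wordCode := by decide +kernel

theorem elementWords_letters : ∀ w ∈ elementWords, ∀ a ∈ w, 1 ≤ a ∧ a ≤ 4 := by decide +kernel

def isElement (w : List ℕ) : Bool := elementCodes.any (Nat.beq (wordCode w))

theorem mem_elementWords {w : List ℕ} (hw : ∀ a ∈ w, IsLetter a) (h : isElement w = true) :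
    w ∈ elementWords := by
  rw [isElement, elementCodes_eq, List.any_map, List.any_eq_true] at h
  obtain ⟨e, he, h⟩ := h
  rw [wordCode_injOn hw (elementWords_letters e he) (by simpa using h)]
  exact he

theorem interp_elementWords {n : ℤ} (hn : IsExotic n) {w : List ℕ} (hw : w ∈ elementWords) :
    interp n w ∈ commonElements ∨ IsTransuranic (interp n w) := by
  rcases List.mem_append.1 hw with hw | hw
  · obtain ⟨e, he, rfl⟩ := List.mem_map.1 hw
    have h3 : ∀ e ∈ commonElements, ∀ a ∈ e, 0 ≤ a ∧ a ≤ 3 := by decide +kernel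
    have : interp n (e.map Int.toNat) = e := by
      rw [interp, List.map_map]
      refine (List.map_congr_left fun a ha => ?_).trans (List.map_id e)
      obtain ⟨h0, h3⟩ := h3 e he a ha
      simp only [Function.comp_apply, id]
      rw [letterValue_of_le (by omega), Int.toNat_of_nonneg h0]
    exact .inl (this.symm ▸ he)
  · refine .inr ⟨n, hn.1, hn.2.1, hn.2.2, ?_⟩
    simp only [List.mem_cons, List.not_mem_nil, or_false] at hw
    rcases hw with rfl | rfl
    exacts [.inl (by simp [interp, letterValue]), .inr (by simp [interp, letterValue])]

/-- The periodic-table fact: the next day of each element cuts into elements. One day of computation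
thus settles all later days. -/
theorem elementWords_closed : (elementWords.all fun w => (cut (look w)).2.all isElement) = true := by
  decide +kernel

theorem isCompound_of_isElement {n : ℤ} (hn : IsExotic n) {w : List ℕ} (hw : ∀ a ∈ w, IsLetter a)
    (h4 : NoFour w) (h : isElement w = true) (m : ℕ) : IsCompound (JHC^[m] (interp n w)) := by
  have hmem := mem_elementWords hw h
  induction m generalizing w with
  | zero =>
    exact ⟨[interp n w], by simp, .singleton _, by simpa using interp_elementWords hn hmem⟩
  | succ m ih =>
    have hcut := (cut_spec (look w)).1
    refine hcut.isCompound hn hw h4 fun p hp => ?_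
    have hpw : ∀ a ∈ p, IsLetter a := fun a ha =>
      look_letters hw h4 a ((hcut.mem_isInfix hp).subset ha)
    have hpe : isElement p = true :=
      List.all_eq_true.1 (List.all_eq_true.1 elementWords_closed w hmem) p hp
    exact ih hpw ((noFour_look w).infix (hcut.mem_isInfix hp)) hpe (mem_elementWords hpw hpe)

/-- Whether a word decays into elements within the given number of days. -/
def decays : ℕ → List ℕ → Bool
  | 0, w => isElement w
  | d + 1, w => bif isElement w then true else (cut (look w)).2.all (decays d)

theorem isCompound_of_decays {n : ℤ} (hn : IsExotic n) {d : ℕ} {w : List ℕ}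
    (hw : ∀ a ∈ w, IsLetter a) (h4 : NoFour w) (h : decays d w = true) {m : ℕ} (hm : d ≤ m) :
    IsCompound (JHC^[m] (interp n w)) := by
  induction d generalizing w m with
  | zero => exact isCompound_of_isElement hn hw h4 h m
  | succ d ih =>
    rw [decays] at h
    rcases he : isElement w with _ | _
    · rw [he, cond_false, List.all_eq_true] at h
      obtain ⟨m, rfl⟩ : ∃ k, m = k + 1 := ⟨m - 1, by omega⟩
      have hcut := (cut_spec (look w)).1
      exact hcut.isCompound hn hw h4 fun p hp =>
        ih (fun a ha => look_letters hw h4 a ((hcut.mem_isInfix hp).subset ha))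
          ((noFour_look w).infix (hcut.mem_isInfix hp)) (h p hp) (by omega)
    · exact isCompound_of_isElement hn hw h4 he m

/-! ### Automata reading words from right to left -/

/-- The transition function of the automaton with table `T`. State `0` is dead, state `1` initial, and
state `2` is reached by the letter `4`, which occurs only at the end of a word. State `s` owns the
bits of `T` from `32 * s` on: ten bits for the target on each of the letters `1, 2, 3`, and one bit
that tells whether the state is accepting. -/
def tableStep (T s c : ℕ) : ℕ :=
  bif Nat.beq c 4 then (bif Nat.beq s 1 then 2 else 0)
  -- The target on letter `c` sits in the ten bits from `32 * s + 10 * (c - 1)` on.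
  else Nat.mod (Nat.shiftRight T (Nat.sub (Nat.add (Nat.mul 32 s) (Nat.mul 10 c)) 10)) 1024

def tableAccepts (T s : ℕ) : Bool :=
  Nat.beq (Nat.mod (Nat.shiftRight T (Nat.add (Nat.mul 32 s) 30)) 2) 1

/-- The state after reading a word from right to left. -/
def tableRun (T : ℕ) (w : List ℕ) : ℕ := w.foldr (fun c s => tableStep T s c) 1

/-- Zero low 32 bits mean that every entry of state 0 is 0, so the dead state is absorbing. -/
theorem tableStep_zero {T : ℕ} (h0 : T % 2 ^ 32 = 0) {c : ℕ} (hc : IsLetter c) :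
    tableStep T 0 c = 0 := by
  obtain ⟨h1, h2⟩ := hc
  have h4 : Nat.beq 1 4 = false ∧ Nat.beq 2 4 = false ∧ Nat.beq 3 4 = false ∧
    Nat.beq 0 1 = false := by decide
  obtain ⟨g1, g2, g3, g5⟩ := h4
  have hmod : ∀ x, Nat.mod x 1024 = x % 1024 := fun _ => rfl
  interval_cases c <;> simp [tableStep, Nat.shiftRight_eq_div_pow, hmod, g1, g2, g3, g5] <;> omega

theorem tableAccepts_zero {T : ℕ} (h0 : T % 2 ^ 32 = 0) : tableAccepts T 0 = false := by
  have hmod : ∀ x, Nat.mod x 2 = x % 2 := fun _ => rfl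
  simp [tableAccepts, Nat.shiftRight_eq_div_pow, Nat.beq_eq_decide_eq, hmod]
  omega

/-! ### The day after, read by a second automaton -/

/-- The progress of reading a word `w` and the next day's word from right to left: the state of the
automaton for `w`, the first letter of the part of `w` read, the start class of the current piece
of the next day's word, and the state of the automaton for the pieces. -/
structure Node where
  source : ℕ
  last : ℕ
  cls : StartClass
  target : ℕ

/-- A mixed-radix packing of the components into one number. The source state is the leading digit
and needs no bound; `Node.bounded` keeps the others below their radices, which makes the key
injective. -/
def Node.key : Node → ℕ
  | ⟨q, a, ⟨h, l, f⟩, s⟩ =>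
    Nat.add (Nat.mul 1024 (Nat.add (Nat.mul 8 (Nat.add (Nat.mul 8 (Nat.add (Nat.mul 8 (Nat.add
      (Nat.mul 2 q) (bif f then 1 else 0))) l)) h)) a)) s

def Node.bounded : Node → Bool
  | ⟨_, a, ⟨h, l, _⟩, s⟩ =>
    and (Nat.ble a 7) (and (Nat.ble h 7) (and (Nat.ble l 7) (Nat.ble s 1023)))

theorem Nat.eq_and_eq_of_mul_add_eq {n x y a b : ℕ} (ha : a < n) (hb : b < n)
    (h : n * x + a = n * y + b) : x = y ∧ a = b := by
  have hab : a = b := by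
    simpa [Nat.mul_add_mod, Nat.mod_eq_of_lt ha, Nat.mod_eq_of_lt hb] using congrArg (· % n) h
  subst hab
  exact ⟨Nat.eq_of_mul_eq_mul_left (by omega) (Nat.add_right_cancel h), rfl⟩

theorem Node.key_injOn {x y : Node} (hx : x.bounded = true) (hy : y.bounded = true)
    (h : x.key = y.key) : x = y := by
  obtain ⟨q, a, ⟨c, l, f⟩, s⟩ := x
  obtain ⟨q', a', ⟨c', l', f'⟩, s'⟩ := y
  simp only [bounded, key, Nat.add_eq, Nat.mul_eq, Bool.and_eq_true, Nat.ble_eq] at hx hy h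
  have h2 : ∀ b : Bool, (bif b then 1 else 0) < 2 := by decide
  obtain ⟨hs, es⟩ := Nat.eq_and_eq_of_mul_add_eq (by omega) (by omega) h
  obtain ⟨ha, ea⟩ := Nat.eq_and_eq_of_mul_add_eq (by omega) (by omega) hs
  obtain ⟨hc, ec⟩ := Nat.eq_and_eq_of_mul_add_eq (by omega) (by omega) ha
  obtain ⟨hl, el⟩ := Nat.eq_and_eq_of_mul_add_eq (by omega) (by omega) hc
  obtain ⟨hq, hf⟩ := Nat.eq_and_eq_of_mul_add_eq (h2 f) (h2 f') hl
  cases f <;> cases f' <;> simp_all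

/-- Prepend the letter `c` to the current piece, or cut and start a new piece. -/
def pushLetter (T' c : ℕ) (k : StartClass) (s : ℕ) : StartClass × ℕ :=
  bif k.splits c then
    bif tableAccepts T' s then (emptyClass.cons c, tableStep T' 1 c) else (emptyClass, 0)
  else (k.cons c, tableStep T' s c)

/-- Put the nodes reached by reading further letters `c`, at most `n` of them and after `m - 1` earlier
ones, before `todo`; `k` and `s` describe the day after once `c` has been pushed. -/
def pushRuns (T T' c : ℕ) (k : StartClass) (s : ℕ) : ℕ → ℕ → ℕ → List Node → List Node
  | 0, _, _, todo => todo
  | n + 1, m, q, todo =>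
    bif Nat.beq (tableStep T q c) 0 then todo
    else
      (⟨tableStep T q c, c, (pushLetter T' m k s).1, (pushLetter T' m k s).2⟩ : Node) ::
        pushRuns T T' c k s n m.succ (tableStep T q c) todo

/-- Put the nodes reached from `x` by reading a run of one of the given letters before `todo`. -/
def Node.succs (T T' : ℕ) (x : Node) (todo : List Node) : List ℕ → List Node
  | [] => todo
  | c :: cs =>
    bif Nat.beq c x.last then x.succs T T' todo cs
    -- A run of `c` contributes its length followed by `c` to the next day. Read from the right, `c`
    -- is pushed once and each possible length 1, 2, 3 is pushed onto that result.
    else pushRuns T T' c (pushLetter T' c x.cls x.target).1 (pushLetter T' c x.cls x.target).2 3 1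
      x.source (x.succs T T' todo cs)

def Node.ok (T T' : ℕ) (x : Node) : Bool :=
  bif tableAccepts T x.source then tableAccepts T' x.target else true

/-! ### Searching the reachable nodes -/

/-- Search trees for natural numbers. -/
inductive KeyTree where
  | leaf
  | node (l : KeyTree) (k : ℕ) (r : KeyTree)

def KeyTree.mem (k : ℕ) : KeyTree → Bool
  | .leaf => false
  | .node l k' r => bif Nat.beq k k' then true else bif Nat.ble k k' then l.mem k else r.mem k

def KeyTree.insert (k : ℕ) : KeyTree → KeyTree
  | .leaf => .node .leaf k .leaf
  | .node l k' r =>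
    bif Nat.beq k k' then .node l k' r
    else bif Nat.ble k k' then .node (l.insert k) k' r else .node l k' (r.insert k)

/-- Insertion and lookup make the same comparisons, so no ordering invariant on the tree is needed.
-/
theorem KeyTree.mem_insert (j k : ℕ) (t : KeyTree) :
    (t.insert k).mem j = true ↔ j = k ∨ t.mem j = true := by
  induction t with
  | leaf => simp [insert, mem, Nat.beq_eq_decide_eq]
  | node l k' r ihl ihr =>
    simp only [insert, Nat.beq_eq_decide_eq, Nat.ble_eq_decide_le, Bool.cond_decide]
    split_ifs with h1 h2
    · subst h1
      simp only [mem, Nat.beq_eq_decide_eq, Nat.ble_eq_decide_le, Bool.cond_decide]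
      split_ifs <;> simp_all
    · simp only [mem, Nat.beq_eq_decide_eq, Nat.ble_eq_decide_le, Bool.cond_decide]
      split_ifs with h3 h4
      · simp
      · exact ihl
      · simp [show j ≠ k by omega]
    · simp only [mem, Nat.beq_eq_decide_eq, Nat.ble_eq_decide_le, Bool.cond_decide]
      split_ifs with h3 h4
      · simp
      · simp [show j ≠ k by omega]
      · exact ihr

/-- Whether all nodes reachable from `todo` that are not in `seen` are fine. -/
def explore (T T' : ℕ) : ℕ → List Node → KeyTree → Bool
  | 0, _, _ => false
  | _ + 1, [], _ => true
  | n + 1, x :: todo, seen =>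
    bif x.bounded then
      bif seen.mem x.key then explore T T' n todo seen
      else bif x.ok T T' then explore T T' n (x.succs T T' todo [1, 2, 3, 4]) (seen.insert x.key)
      else false
    else false

theorem mem_pushRuns {T T' c : ℕ} {k : StartClass} {s n m q : ℕ} {todo : List Node} {x : Node} :
    x ∈ pushRuns T T' c k s n m q todo ↔ x ∈ pushRuns T T' c k s n m q [] ∨ x ∈ todo := by
  induction n generalizing m q with
  | zero => simp [pushRuns]
  | succ n ih =>
    rw [pushRuns, pushRuns]
    rcases Nat.beq (tableStep T q c) 0 with _ | _
    · simp only [cond_false, List.mem_cons, ih (m := m.succ), or_assoc]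
    · simp

theorem Node.mem_succs {T T' : ℕ} {x y : Node} {todo : List Node} {cs : List ℕ} :
    y ∈ x.succs T T' todo cs ↔ y ∈ x.succs T T' [] cs ∨ y ∈ todo := by
  induction cs with
  | nil => simp [succs]
  | cons c cs ih =>
    rw [succs, succs]
    rcases Nat.beq c x.last with _ | _
    · simp only [cond_false]
      rw [mem_pushRuns, ih, mem_pushRuns (todo := x.succs T T' [] cs), or_assoc]
    · exact ih

/-- A set of nodes closed under the transitions, all of whose members are fine. -/
structure IsStable (T T' : ℕ) (S : Set Node) : Prop where
  ok : ∀ x ∈ S, x.ok T T' = true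
  succs : ∀ x ∈ S, ∀ y ∈ x.succs T T' [] [1, 2, 3, 4], y ∈ S

/-- The invariant of a worklist search: `S₀` holds the treated nodes, whose successors are treated
or pending, and every key in `seen` belongs to a node of `S₀`. Since keys are injective on bounded
nodes, a known key means a known node. Once nothing is pending, `S₀` is stable. -/
theorem exists_isStable_of_explore {T T' fuel : ℕ} {todo : List Node} {seen : KeyTree} {S₀ : Set Node}
    (h : explore T T' fuel todo seen = true)
    (hS : ∀ x ∈ S₀, x.bounded = true ∧ x.ok T T' = true ∧
      ∀ y ∈ x.succs T T' [] [1, 2, 3, 4], y ∈ S₀ ∨ y ∈ todo)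
    (hseen : ∀ k, seen.mem k = true → ∃ x ∈ S₀, x.key = k) :
    ∃ S, S₀ ⊆ S ∧ (∀ x ∈ todo, x ∈ S) ∧ IsStable T T' S := by
  induction fuel generalizing todo seen S₀ with
  | zero => simp [explore] at h
  | succ n ih =>
    cases todo with
    | nil =>
      exact ⟨S₀, subset_rfl, by simp, fun x hx => (hS x hx).2.1, fun x hx y hy => by
        simpa using (hS x hx).2.2 y hy⟩
    | cons x todo =>
      rw [explore] at h
      rcases hb : x.bounded with _ | _
      · simp [hb] at h
      rcases hm : seen.mem x.key with _ | _
      · rcases hok : x.ok T T' with _ | _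
        · simp [hb, hm, hok] at h
        simp only [hb, hm, hok, cond_true, cond_false] at h
        refine (ih (S₀ := insert x S₀) h ?_ ?_).elim fun S ⟨h1, h2, h3⟩ => ?_
        rotate_right
        · refine ⟨S, (Set.subset_insert x S₀).trans h1, fun y hy => ?_, h3⟩
          rcases List.mem_cons.1 hy with rfl | hy
          · exact h1 (Set.mem_insert _ _)
          · exact h2 y (Node.mem_succs.2 (.inr hy))
        · rintro y (rfl | hy)
          · exact ⟨hb, hok, fun z hz => .inr (Node.mem_succs.2 (.inl hz))⟩
          · obtain ⟨g1, g2, g3⟩ := hS y hy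
            refine ⟨g1, g2, fun z hz => ?_⟩
            rcases g3 z hz with hz | hz
            · exact .inl (Set.mem_insert_of_mem _ hz)
            · rcases List.mem_cons.1 hz with rfl | hz
              · exact .inl (Set.mem_insert _ _)
              · exact .inr (Node.mem_succs.2 (.inr hz))
        · intro k hk
          rcases (KeyTree.mem_insert _ _ _).1 hk with rfl | hk
          · exact ⟨x, Set.mem_insert _ _, rfl⟩
          · obtain ⟨y, hy, hyk⟩ := hseen k hk
            exact ⟨y, Set.mem_insert_of_mem _ hy, hyk⟩
      · simp only [hb, hm, cond_true] at h
        obtain ⟨y, hy, hyx⟩ := hseen _ hm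
        obtain rfl : y = x := Node.key_injOn (hS y hy).1 hb hyx
        refine (ih (S₀ := S₀) h ?_ hseen).elim fun S ⟨h1, h2, h3⟩ => ?_
        rotate_right
        · refine ⟨S, h1, fun z hz => ?_, h3⟩
          rcases List.mem_cons.1 hz with rfl | hz
          exacts [h1 hy, h2 z hz]
        · intro z hz
          obtain ⟨g1, g2, g3⟩ := hS z hz
          refine ⟨g1, g2, fun t ht => ?_⟩
          rcases g3 t ht with ht | ht
          · exact .inl ht
          · rcases List.mem_cons.1 ht with rfl | ht
            exacts [.inl hy, .inr ht]

/-- The data `k`, `s` describe a cutting of `v` all of whose pieces except possibly the first one are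
accepted by the automaton `T'`, unless the state `s` is dead. -/
def Tracks (T' : ℕ) (k : StartClass) (s : ℕ) (v : List ℕ) : Prop :=
  s = 0 ∨ ∃ ps, IsCutting ps v ∧ k = startClass (ps.headD []) ∧ s = tableRun T' (ps.headD []) ∧
    ∀ p ∈ ps.tail, tableAccepts T' (tableRun T' p) = true

/-- `pushLetter` mirrors `IsCutting.extend` and `IsCutting.split`; a completed piece that `T'`
rejects sends the state to the dead one for good. -/
theorem Tracks.push {T' : ℕ} (h0 : T' % 2 ^ 32 = 0) {k : StartClass} {s c : ℕ} {v : List ℕ}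
    (hc : IsLetter c) (h : Tracks T' k s v) :
    Tracks T' (pushLetter T' c k s).1 (pushLetter T' c k s).2 (c :: v) := by
  rw [pushLetter]
  rcases h with rfl | ⟨ps, hps, hk, hs, hacc⟩
  · left
    rw [tableAccepts_zero h0, tableStep_zero h0 hc]
    rcases k.splits c with _ | _ <;> rfl
  · rcases hsp : k.splits c with _ | _
    · right
      cases ps with
      | nil =>
        obtain rfl : [] = v := hps.flatten_eq
        exact ⟨[[c]], .singleton c, by rw [hk]; rfl, by rw [hs]; rfl, by simp⟩
      | cons u ps =>
        exact ⟨(c :: u) :: ps, hps.extend c, by rw [hk]; rfl, by rw [hs]; rfl, hacc⟩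
    · rcases ha : tableAccepts T' s with _ | _
      · exact .inl rfl
      · right
        cases ps with
        | nil => subst hk; simp [startClass, StartClass.splits, emptyClass, Nat.beq_eq_decide_eq] at hsp
        | cons u ps =>
          refine ⟨[c] :: u :: ps, hps.split (hk ▸ hsp), rfl, rfl, fun p hp => ?_⟩
          rcases List.mem_cons.1 hp with rfl | hp
          exacts [hs ▸ ha, hacc p hp]

theorem tableRun_replicate_append (T m c : ℕ) (w : List ℕ) :
    tableRun T (List.replicate m c ++ w) = (fun s => tableStep T s c)^[m] (tableRun T w) := by
  induction m with
  | zero => rfl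
  | succ m ih => rw [Function.iterate_succ_apply', ← ih]; rfl

theorem mem_pushRuns_iterate {T T' c : ℕ} (hT : tableStep T 0 c = 0) {k : StartClass} {s n j m q : ℕ}
    (hj : j < n) (hq : (fun s => tableStep T s c)^[j + 1] q ≠ 0) :
    (⟨(fun s => tableStep T s c)^[j + 1] q, c, (pushLetter T' (m + j) k s).1,
      (pushLetter T' (m + j) k s).2⟩ : Node) ∈ pushRuns T T' c k s n m q [] := by
  induction n generalizing j m q with
  | zero => omega
  | succ n ih =>
    have hne : tableStep T q c ≠ 0 := by
      intro h
      apply hq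
      rw [Function.iterate_succ_apply, h]
      exact Function.iterate_fixed hT j
    rw [pushRuns, Nat.beq_eq_decide_eq, decide_eq_false hne, cond_false]
    cases j with
    | zero => simp
    | succ j =>
      rw [Function.iterate_succ_apply] at hq ⊢
      have := ih (m := m.succ) (by omega) hq
      rw [show m + (j + 1) = m.succ + j by omega]
      exact List.mem_cons_of_mem _ this

theorem Node.mem_succs_iterate {T T' : ℕ} (x : Node) {c : ℕ} (hT : tableStep T 0 c = 0) {cs : List ℕ}
    (hc : c ∈ cs) (hx : c ≠ x.last) {j : ℕ} (hj : j < 3)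
    (hq : (fun s => tableStep T s c)^[j + 1] x.source ≠ 0) :
    (⟨(fun s => tableStep T s c)^[j + 1] x.source, c,
      (pushLetter T' (1 + j) (pushLetter T' c x.cls x.target).1 (pushLetter T' c x.cls x.target).2).1,
      (pushLetter T' (1 + j) (pushLetter T' c x.cls x.target).1
        (pushLetter T' c x.cls x.target).2).2⟩ : Node) ∈ x.succs T T' [] cs := by
  induction cs with
  | nil => simp at hc
  | cons d cs ih =>
    rw [succs]
    rcases List.mem_cons.1 hc with rfl | hc
    · rw [Nat.beq_eq_decide_eq, decide_eq_false hx, cond_false, mem_pushRuns]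
      exact .inl (mem_pushRuns_iterate hT hj hq)
    · rcases Nat.beq d x.last with _ | _
      · exact mem_pushRuns.2 (.inr (ih hc))
      · exact ih hc

/-- The certificate that the automaton `T'` accepts the pieces of the day after of all words that the
automaton `T` accepts. -/
def isNextDay (T T' : ℕ) : Bool :=
  -- The modulus is 2 ^ 32, so both automata have an absorbing dead state. The number 4000 only
  -- bounds the search: running out of it yields `false`.
  and (Nat.beq (Nat.mod T 4294967296) 0) (and (Nat.beq (Nat.mod T' 4294967296) 0)
    (explore T T' 4000 [⟨1, 0, emptyClass, 1⟩] .leaf))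

/-- Reading `w` run by run from the right stays inside the stable set, and the node reached tracks a
cutting of `look w`. All pieces but the first were accepted when they were cut off; `Node.ok` at the
final node adds the first. -/
theorem exists_isCutting_of_isNextDay {T T' : ℕ} (h : isNextDay T T' = true) {w : List ℕ}
    (hw : ∀ a ∈ w, IsLetter a) (h4 : NoFour w) (hacc : tableAccepts T (tableRun T w) = true) :
    ∃ ps, IsCutting ps (look w) ∧ ∀ p ∈ ps, tableAccepts T' (tableRun T' p) = true := by
  simp only [isNextDay, Bool.and_eq_true, Nat.beq_eq] at h
  obtain ⟨h0, h0', h⟩ := h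
  replace h0 : T % 2 ^ 32 = 0 := h0
  replace h0' : T' % 2 ^ 32 = 0 := h0'
  obtain ⟨S, -, hS, hcl⟩ := exists_isStable_of_explore (S₀ := ∅) h (by simp) (by simp [KeyTree.mem])
  have key : ∀ w : List ℕ, (∀ a ∈ w, IsLetter a) → NoFour w → tableRun T w = 0 ∨
      ∃ x ∈ S, x.source = tableRun T w ∧ x.last = w.headD 0 ∧ Tracks T' x.cls x.target (look w) := by
    intro w
    induction w using List.runInduction with
    | nil =>
      exact fun _ _ => .inr ⟨⟨1, 0, emptyClass, 1⟩, hS _ (by simp), rfl, rfl,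
        .inr ⟨[], .nil, rfl, rfl, by simp⟩⟩
    | append m a v hv ih =>
      intro hw h4
      have ha : IsLetter a := hw a (by simp)
      have hm := h4.run_le
      have hT := tableStep_zero h0 ha
      rw [tableRun_replicate_append, look_replicate_append m hv]
      rw [or_iff_not_imp_left]
      intro hne
      rcases ih (fun b hb => hw b (by simp [hb])) (h4.infix (List.suffix_append _ _).isInfix) with
        hz | ⟨x, hx, hsrc, hlast, htr⟩
      · rw [hz] at hne
        exact absurd (Function.iterate_fixed hT _) hne
      · rw [← hsrc] at hne ⊢
        have hal : a ≠ x.last := by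
          rw [hlast]
          have := ha.1
          cases v with
          | nil => simp; omega
          | cons b v => simpa [eq_comm] using hv
        have hmem : a ∈ [1, 2, 3, 4] := by
          obtain ⟨h1, h2⟩ := ha
          interval_cases a <;> simp
        refine ⟨_, hcl.succs x hx _ (x.mem_succs_iterate hT hmem hal (by omega) hne), rfl, rfl, ?_⟩
        rw [show m + 1 = 1 + m by omega]
        exact (htr.push h0' ha).push h0' ⟨by omega, by omega⟩
  rcases key w hw h4 with hz | ⟨x, hx, hsrc, -, htr⟩
  · rw [hz, tableAccepts_zero h0] at hacc
    cases hacc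
  · have hok := hcl.ok x hx
    rw [Node.ok, hsrc, hacc, cond_true] at hok
    rcases htr with hz | ⟨ps, hps, -, hs, hall⟩
    · rw [hz, tableAccepts_zero h0'] at hok
      cases hok
    · refine ⟨ps, hps, fun p hp => ?_⟩
      cases ps with
      | nil => simp at hp
      | cons u ps =>
        rcases List.mem_cons.1 hp with rfl | hp
        exacts [hs ▸ hok, hall p hp]

/-! ### Words accepted by an automaton -/

/-- Whether all words accepted by the automaton `T` satisfy `P`, provided that there are only finitely
many of them and they are shorter than the first numerical argument. -/
def allAccepted (T : ℕ) (P : List ℕ → Bool) : ℕ → ℕ → List ℕ → Bool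
  | 0, _, _ => false
  | n + 1, s, u =>
    and (bif tableAccepts T s then P u else true) ([1, 2, 3, 4].all fun c =>
      bif Nat.beq (tableStep T s c) 0 then true else allAccepted T P n (tableStep T s c) (c :: u))

theorem tableRun_append_of_eq_zero {T : ℕ} (h0 : T % 2 ^ 32 = 0) {u w : List ℕ}
    (hu : ∀ a ∈ u, IsLetter a) (h : tableRun T w = 0) : tableRun T (u ++ w) = 0 := by
  induction u with
  | nil => exact h
  | cons c u ih =>
    change tableStep T (tableRun T (u ++ w)) c = 0
    rw [ih fun a ha => hu a (by simp [ha])]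
    exact tableStep_zero h0 (hu c (by simp))

theorem allAccepted_spec {T : ℕ} (h0 : T % 2 ^ 32 = 0) {P : List ℕ → Bool} {n : ℕ} {u w : List ℕ}
    (h : allAccepted T P n (tableRun T w) w = true) (hu : ∀ a ∈ u, IsLetter a)
    (hacc : tableAccepts T (tableRun T (u ++ w)) = true) : P (u ++ w) = true := by
  induction n generalizing u w with
  | zero => simp [allAccepted] at h
  | succ n ih =>
    rw [allAccepted, Bool.and_eq_true, List.all_eq_true] at h
    rcases List.eq_nil_or_concat' u with rfl | ⟨u, c, rfl⟩
    · have h := h.1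
      rw [List.nil_append] at hacc ⊢
      rwa [hacc, cond_true] at h
    · have hc : IsLetter c := hu c (by simp)
      have hmem : c ∈ [1, 2, 3, 4] := by
        obtain ⟨h1, h2⟩ := hc
        interval_cases c <;> simp
      have h := h.2 c hmem
      have hu' : ∀ a ∈ u, IsLetter a := fun a ha => hu a (by simp [ha])
      have he : u ++ [c] ++ w = u ++ (c :: w) := by simp
      rw [he] at hacc ⊢
      rcases hz : Nat.beq (tableStep T (tableRun T w) c) 0 with _ | _
      · rw [hz] at h
        exact ih h hu' hacc
      · have : tableRun T (c :: w) = 0 := Nat.eq_of_beq_eq_true hz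
        rw [tableRun_append_of_eq_zero h0 hu' this, tableAccepts_zero h0] at hacc
        cases hacc

/-- All words accepted by the automaton `T` are compounds after at least `d` days. -/
def AcceptedDecay (T d : ℕ) : Prop :=
  ∀ n : ℤ, IsExotic n → ∀ w : List ℕ, (∀ a ∈ w, IsLetter a) → NoFour w →
    tableAccepts T (tableRun T w) = true → ∀ m, d ≤ m → IsCompound (JHC^[m] (interp n w))

theorem acceptedDecay_of_allAccepted {T d k : ℕ} (h0 : T % 2 ^ 32 = 0)
    (h : allAccepted T (decays d) k 1 [] = true) : AcceptedDecay T d := by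
  intro n hn w hw h4 hacc m hm
  refine isCompound_of_decays hn hw h4 ?_ hm
  have := allAccepted_spec h0 (u := w) (w := []) h hw (by simpa using hacc)
  simpa using this

/-- One day turns an accepted word of `T` into a splitting with pieces accepted by `T'`, hence the
extra day. -/
theorem AcceptedDecay.of_isNextDay {T T' d : ℕ} (h : AcceptedDecay T' d) (hT : isNextDay T T' = true) :
    AcceptedDecay T (d + 1) := by
  intro n hn w hw h4 hacc m hm
  obtain ⟨m, rfl⟩ : ∃ k, m = k + 1 := ⟨m - 1, by omega⟩
  obtain ⟨ps, hps, hall⟩ := exists_isCutting_of_isNextDay hT hw h4 hacc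
  exact hps.isCompound hn hw h4 fun p hp =>
    h n hn p (fun a ha => look_letters hw h4 a ((hps.mem_isInfix hp).subset ha))
      ((noFour_look w).infix (hps.mem_isInfix hp)) (hall p hp) m (by omega)

/-! ### The ten automata, their certificates and the bound of 27 days -/

/-- The automaton of all words without four equal letters in a row that contain the letter `4` at
most at the end. -/
def table0 : ℕ :=
  0x4000180340b0180340a01803409000034090200340901c03409018004090180540901804409018034090180300000000

/-- The automaton of the pieces of such words after 1 day. -/
def table1 : ℕ :=
  0x40f0001c4000780e40f07800415000214000482001b08c0601807c220150202141d000204050500301807c134000781c41b0680a4150440741d000004190001c4000000e01b050064050680641900000418000130150201041805c1641500007400050004090000740d0001340f048004090441040f0000e40d0000c40502c0a40902007000000064050100300000000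

/-- The automaton of the pieces of such words after 2 days. -/
def table2 : ℕ :=
  0x439000294000f00044410c2001e020100241b42340e000420241284241e0006c461074200460005c4121001c0321ac2c433000224460006a4321a400024190420251604201e07420000120520680744e0001442c00019c6640e0003a0371286502419020409020634350003b0460000f43516c0003215400400000624610741c02405c6041e0005f0001783805d0005c40016c3a4300003b04614445425000420281001c433000180461205a400000590251603e05715820414154004000000040505c5400014c5200014450400000504250001501e0743e40e0004f4090744e400000224001344c0001244b4250003e0241282000012422435120474460004544410c42441000000281003e0250d01501e0203f40e0003e40c0f42301e0202c4000f03b4330003a4390000f4000003803705c36435000000250d022433000000320c400430000004000bc2e0000b42b0280442c4000002b42a0002942809c10400000264250002202405c2340e0002240c0842041f0000001e0741c40006c1a4000001940e0001840005c004090001640e0001541404c00412044100000000f40e0000d40c02c0a40902007000000064050100300000000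

/-- The automaton of the pieces of such words after 3 days. -/
def table3 : ℕ :=
  0xb50006405e078df000230de04a3746400037033400000db425000290b5000a54141a4000b522400425000da4d9078ae03b2243348100064000360b200035c6801f078104000e40007d2303c01f198d60d521cd406a000640a6000cc400000d307d000d200034400420000d007d000cf0003389c023334210b51f8004a6000000b5000cc02832c214610008303e16cca4000006b088324260b500000461000c807d230c7433000c6400000bb000314c40002803307d0006b000000c303b308334250008d4710000001f1bcc101f1bcc00882fc4801f078ae0352f833425000bb0bd2f05a000074bb000190a106a2e80001f078b90b82dc5a03b2240000018cb60a6000004b50000046a2d0004b300000082000aa05c2c8b100000033400000b00af078ae481000ad400000ac0002ac0006a04c0007d000aa0001f833400000a94250002f0a829c10400000990a6000a507d000410542903305c22c5a42500038000000a30002686b03b2883341422400400000a100028015000000290001185701f0789f08821c644000001502e14c9e0002749c02826c210002689940e0009848f0785d03e16c97088258954330009405424c3305c0f48b400000240282482106a1c8004000009140e0009048f1988e05415c334000008d0002308b03b1c0004000008a4140e800471224004810000008821c1503b1c0330000748640000085000190844250001547100064061000830820004106a00000481000800000007f0001f80007d0007c4000007b4520000003b1e8000000747907809c770281d8214001d4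74400000734141c8004711c0000331bc334250006e06d0646c4180006b00013c2406a1a400033078334000006800013c6701f198650000006400018c4540000062461000600430005f05e0785d4000003305c16c5a00016458400000570281585505414c3345200033023144214000000003b1403300013c4e01f1344c4000004b4160000044a12448447000000000dc45000118334000004540e000440430004241800041000000404000003640e0003f03e0f43c41400000000074244250000003b0e8004000e4380000dc360350d03340000032431000304000002f02e0b42c0000742b4000002a4000002902809c2642500024023088214200000001f078000000741c4000001b40e0001a40006400418000174160001541404c00412044100000000f40e0000d40c02c0a40902007000000064050100300000000

/-- The automaton of the pieces of such words after 4 days. -/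
def table4 : ℕ :=
  0x6724c65000001570a70009b0c655955000550000830001003154c3103a001520000e45806d48467400001510d72795000053c00000538310004d54d0001984b11e5305a059434000701bc31031418314310014b00019c00083000530c3484000c92745a4000014a491000b714900148400000e903351c310c631410033518000005140040000144000001430cb001420d700141000500610313f0290334fc00400000b747a0013e13d000db4000009f0594f09d00019c534000013b4000013a0004e4000000c5380a44dc0006719cdb400001360004d46e0004d0ac0004186a0313f0db08f0009f0d74d1330d7000e70c30013208b0013111e4745a000299300594400012f1e00012e3152d12c4ac000410012a1290008d400001281220009b400001270d3078db08b0009b0cb001260d7001250cb001241230008d07a0003b1220010006d484000c3001200000011f11e474100254705300046d1a06700029033464310cb001180cb0004003345c00000199160254541003145031400000ea05c44d12400000710313303148f0008c1114403e0000d4894160010f0000010e483000000000e50d0004310b0c64290910841c53400000d80004183100041504067000db03340c314f61e000031000310334080047a0000003322000000404000dd00100400000ff00013c154910009f0cb000000003f8470c63f4230313f031400000c0041000fb0333e831400000f9416000000f83dc004f625000400000f50f43cc5a000000f20f13c0ef0003b800000000220001989208f0008c0003b40006d3b00007a00042000000e70333ac00000000ea0000005d0000d43d000000e90003a0004890000008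e000e700026c31400000e6067198e5491000640cb00010400000e4400000e30e238431000380be02137c5348f000de0dd0003e0dc000db0003680006d36400000114d80d70008d05c3589d400000d500013cd40d3348d1400000d04c30000003333c294ce00000000334004000006304d0780000033031400000890cb000ca03a0003e0c92c45a00000067431000c803131c3100000026031110310c6314530313103105c2b0100c3000000331e000000000c20890d800000000c10001a4c000000053400000924000006e0002fcbe000000310252f453400000bc43c000bb02e000ba0b9000b8000000b7491000b608b000b5400000b40332cc0043c000420b22c4b0431000af0312b831000000ad4000003705c2b05a06d2ac000001484341b000aa0a9000a84a7298a50a428c3140000034491000a2000000a1400000a00000009f0002789d0332700000026c000001149a4000009949100000498000000121e0004000009700025800000148950332500000024c924910006e446000670312403108f0003108e0008d06d000000000008c08b0003d0000008a0892200043c000870862148408300000082204800311fc3107e1f4100001147c4000007b07a000004140d8004791e0000311dc31000000760751d07303a00072000000710701bc6e06d1b0000311ac314000006a0001a46806719865400000640000001003118c310000006240000061400000150000006005f0005e4000005d05c16c5a0591605703115831400000310551505340000000000148510331403100013c4e04d1304b4000004a44900000033120474460000000011443000110314000004303c000420410004003f0003e4000003d03c0003b03a0e438000000370330d8000000d4340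330c831000000304000002f02e0002d4000002c02b0a82900000028400000274000002602509023400000220210801041f00000000078000000001d4000001c41b0001a40006400418000174160001541404c00412044100000000f40e0000d40c02c0a40902007000000064050100300000000

/-- The automaton of the pieces of such words after 5 days. -/
def table5 : ℕ :=
  0x33208000e700000400001ce05d001cd0006405e03117d3943100000000001cc0de001cb0cb00132000001ca000001c9000001c81c7718000f3561c5000711c3010120b600017400000708a0400001010ca4e8000277040000070000400000c10006fc00125001be0cb0005d128001bd1bc000270274c0000dd001bb000001ba033348000316e431031404310316e031400001b70006d89d09c6d59d000001b4000555690006cd7f0526c8000316c431000428ff0b04f0001b06bc0040000159400001ae1230007600060dad400001ac400001ab1aa00000000001a904e6a00012e001a70006980004e6940000009c0003369000400001a304e68800027684000006800003f0014319f000760000019e0f33c99d0000019c00000171000208310000019b0004319a000329990000019803165c3105565853000654311770000000014851000651930006494e00000191000640310480014e0000c58f00000159087638000006358c18b44c0011f4f05304e6280040000129189000cd177000cc18800000400001871860000040000137185001840390003c00060c73400001824000017a027340000336043140000180469000000003290d0f3560ae1195fc530005f8000ce0017d0000017c0334c80017b000000000017a0000017912800178177001760000016104e5d400000398000335d0000335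cc000004c800400000d4125000000315c831400001711705bd6e400001504000016d0480016c0000016b0b05a969000001680000016700004000400001660315943140000164000431630000016212500161039000970005800002757c00128000004310015e0314e831000120000005755c4000015b0480015a0000005d00028d590f35609a00055d56400000a20005553c05d0013900055153031548b603100031000000ac0000c551000001500000014f0481214e400000f84000014d14c000004000007b078000df02752c0003b0014a1493f5481470000004e51800145000311440014314200076400001414dd000004000014013f0013e0004f53c4000013b02b4e93903b000cd077000cc0330000000000138000001371250013612e0003c0004d4000ce001340de0013300000079000001320271c400131000760004c0000004bc0012e000760004b4000000012c0ce0012b0000012a000000410001f00000000129400000a603129c3103300031128001270ce00126125001241230003c0270000000028d22000329214000012011f250b10314783111d4711b03146831119461170000011600000115478000df11444c9704e448000dd001110000011010f4389a4000010d000430580000010b03118000000429090004209d1074189a000001050000010403140c310c04085303140400431001000553fc530003f8310253f4000003f0fb000000fa400000f9010000b6000000f80ce000000f700000400000f60ce0003a0de00038400000f5000128580003d0440f33c8f10313c03100e000310ef000ee0ed0003c0273b0000000d4eb0333a831400000e904e3a0004e7398000e53905303f0000000038c31000000a20e238400027380000b400000000000df0de000970dd00000000000dc4000007304e36c00000000d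a027364004d80000000035c00400000d6027354000001f8d4000000d30000002703134800400000d10003400000033c00427000000ce000cd000000cc0cb00000010328c9400000c8000000480c73189a478000c50c4000970b40009a00030c0004e30800000000c10c02fcbe0312f431000000bc400000bb000128ba02b2e4b80332dcb6400000b54b4000000002cc000312c831055150b10b02bc00000000ae000000ad400000ac0002ac31052144aa0312a431000000a800029c31000000a603129431000000a400028ca20000009a000000a1400000a003127c310002789d09c26c9a01b0003a02e0009909800097027258000952509343100092031244310000009004e23c000000008e08d0008c08b0008a04e0c4894000008808721831400000850272100002720c000002080048100000080000000000007f0001f87d0331f0000000007b07a0000040000079078000310770007604e000000000007507400073000000720001c400000000150701bc6e0311b4310551b01f0000006b4000006a069000000311a031000000670661946406300062000000610311803103117c314000005e0000002205d0ac5c4000005b000000100000005a40000059400000580100005700000056055150530521445003113c314000003104e13400400000000000d44c03112c310001284900012048400000474460000003311444443000000000004200000031400000410000004003f0003e03d0003c4000003403b0003a03900038437000000000d8000000d4340330c831000000304000002f02e0002d4000002c02b0a82900000028400000270000002602509023400000220210801f41600000000078000000001d4000001c01b0001a40006400418000174160001541404c00412044100000000f40e0000d40c02c0a0090200700000006405010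0300000000

/-- The automaton of the pieces of such words after 6 days. -/
def table6 : ℕ :=
  0x9a205000bb000002320007ca31000002300008bc00000794000008b97f125000000008b4310000022c000000cb0000022b116000004000018b22a27c000317ec000000022912500228000002272260003106300000163000e703152e250000022400000223000002220003a62122087c6f21e8757c0eb0021c033484000000021b21a864000000021821700000000858000c500000000854001208500040000213031550310311e03116339c00000834c84000011c4000015c04f414000e70011b00021612000844000006b8f821083c004000020e20d830000cb4e09102782c000c50020a0bc002020000020900000208000001a4120002070950015f000002062050012c0000020400080c310eb00202000804000e7000ef084800000a97fc000337f800104001fd000001fc0337ec0000000163000001330317e8311f97e06f03162c3103128431000001f700060831000001f61e47d4000007d138000001f30007c9f11f000000000001ef0bf7b86f03129431000180000002715d0007b49a000001ec000001eb0007a9560007a4cb1e879c004000015d400001e6000001e51e450c000313f000000635e302778800400001e1400001e01df00000000001de1dd000000007700004f76c000df001da000764000c5001330e7001d8000001d702775800400001d5000001d40003255c1d3000d2000001d20997446f000001d0125001cf000001ce000734000410013e1cc00075000001cb0eb000bb000001ca0007240003a00000000001c8431000f4000001c7057001a003171831000000570003b83104100000000001c5000001c400070cc8400001c2000001c1031700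310316fc310cb6f8910006f4311bc50c6f03c00145000001bb1ba000000316e431000001b8000001b7000001b60b66d491000001b40005f0310006cc000006c8000006c5b00846bc0003152c310006b9ad1ac41c001206ac00027344000006a8004000018003138c000316a4310936a000000001a704f00000000001a61a50013312a001a4000001a300068800400001a106c001a019f0000019e0019d19c0019b0006359a400001994000018c03366031000001970006580000039c0003127c001956506f10b64d7c000325920003b80019100000000000c85900000018f00031132000750276380001f000000006347f0000018c03162c004310018a00062400063001880000018704f6180000009c000336140002761000400000c803160c3100060800000001810002e00000000180000000914000017f0275f80057d000000315f0310005ece817a5e46f000001780000017740000176000001750e7001740935cd7200000171000001700001b0004000016f4000016e0003a56d0315b0311200016b0df000750000016a0005a4000275a000000001674000016600012c1505700165000001641630000016258491031580000000015f0000015e0000015d0000015c0000015b0005689a000395590000015800055d56031554ab000550310000006c0000015310400000400001520314840000000151150000004310000000053c310000014e027534000000014c0000c54b0000014a0000d47f40000149077000bd148000bb02751c001460014514450d4204f504001400003113f0013e13d000750000013c13b000004000013a0004e53800000137400001360af4d4001340013313200131130000000000012f0271b4000274b8000000012d0000012c12b0003112a00000000001290004a0150000012700049800125001240000012300000122000484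00120000000000011f0000011e4000011d0003a51c0570011b0000011a000001191180000003145c00116001150000011402700000000001130002711200039cff400000151114409103143c3110e4346f0314303110b42909400000bd10841c00000001060274140010400103000001021014006f000000ff0003f8000313f4310313f031000000fb000000fa0f93e0910f7000000f600075000000f503100000400000f40003ccf2000000f1000000f0057000ef0333b8000ed000000000003d0c5000ec0eb000ea4000005c0003a4e8000000e7000000e600039445000000e403138c310e2000310e1000e00df0003e027378000000d4dd03337031000000db03c0000004f3680009509c000d9360000d70000000035800000000150d53500002734c00076000d200034400000000d0000000cf4ce000000003340040000034027330000cb32891000324c8000000c700031800427000000c5000c4000000c3400000c206c000c1000000c00bf2f86f000000bd0bc000bb0a900000000000ba0002e40004f2e000000000b70b62d4b40312cc31000000b2400000b100012cb00af2b8ad0332b0ab000000aa4a9000000002a00003129c31053298910932480003129400000000a4000000a3000000a200028431000000a003127c31027278000000009d000270150000006f00026c9a0992606f4000002701b0009702e00096095000000272500009324891090000004310008f000238310000008d027230000000008b08a000890880008704f0c4860000008508420c004000008202720400027200004000007f07e000000330000047d00000000000420331f0000000007b4160000007a00000000000790311e0000770003107600075000000740001cc00000000720711c06f0311b8310271b4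6c0000006b0000006a069000000311a031000000670661946406300062000000610311800003117c310000005e0001745c4000004a0000005b031000310000005a40000059000000580570005600000055000000540531480000000051031140004000003104f13800400000000000d44d0311303100012c4a00000049000000484470000003311845444000000000004300000031400000420410004003f0003e4000003d03c0003b03a0003943800000000000370000d8000000d4340330c831000000304000002f02e0002d4000002c02b0a82900000028000000270000002600009424400000230220842041f00000000078000000001d4000001c01b0001a40006400418000174160001541404c00012044100000000f40e0000d40c02c0a00902007000000064050100300000000

/-- The automaton of the pieces of such words after 7 days. -/
def table7 : ℕ :=
  0x8e4394000017a17d001f70000023800094c000000025d25c0002c0000025b0000025a0009640004f48c86000962571c995800000002550004722a0000025402694c000008b800112000bb000948000f700000000944000267d000000940000000024f0000024e000934000109300012792c860009281000000135249574000109200000091c0000091800245000101a60000064400000000002430000024201090400000002400000023f0000023e0004723d0000023c0000023b23a8e4862380000000000237000002360007f0000007e81000000235000002342338c800000001270007e80000000231000002300007b0004000022f0268b8000000022d62c0000022b000004000022a000002290001140000000228227000000002c99b0008980000000225000002242230000022200000000002212200002c01087c000008780013e4a4000000021d0000021c0000021b183608680000021a13e002190000008621885c000000021607b8540015c850db0000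0213212845480008420f0000020e0008340003156000026830000000020b00082800209000000008200020700000000819c60268140003181000000000c920300010103000bb0000020200080400200000000007fc000007f800000001fd01016c000107f000000001fb0107e810000001f9400001f812b001f712b114000107d8000007d439000168104000019b04b7d0000007cc000007c800000001f11f07bc86000001ee400001ed1ec7ac000000014409d614000007a810000000bb0262e8001e900000000001e8400001e71a6001e6000001e500079000000001e3000001e213e001e1010000bb000001e0000001df000001de000001dd00077010000001db000001da00076400026760000006840000075c000e1001d6000001d51d40000001074c00000001d20007448601074010000001cf000001ce000001cd1cc608680106f01001064c10000001cb000728000005ed441c97200000071dc6000001c50007113c000001c3000001300450012e1c200000000001c100000068000001c0000001bf410000000006f8000006f4000106f000400001bb1ba6e40013e6e000000001b7000099b600035c000266d4000002a800000001b40006cc001b2000001b1000000266c000400001af400001ae1ad00000000001ac1ab0002c0006a80004b6a4001a800000112001a100069c001a6001a5000001a417435086045001a3000001a2026684001a00000000067c000000019e0000019d0000019c0000019b0000019a000664000266600003d000000000019719600000000001950000008b0002280000065000410000d200064c1000000192400001911900018f010638100000018d0000018c00062c394000018a13e624000106200001061c1018661486000610101836088602660400038001130000018017f000000105f8100000017d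400000850005f08b0005ed7a00000179000001780005dc150a829c8607b5d8000105d4100005d0d41735c8000003540000000171000001700005bc0004b000000000016e000124390000016d0000016c16b0016a0ca0016900000168000324001670000000000022166001651640002c02658c0000047162000001614000011a010580000000015f000578000105740015c56c680e7569480002c959000560000000015713e00000000001560000003901600000000001171550002c5540000015300000152000bb026544001180001006d000bb000001500000014f09c53800031534000000014c14b000000000014a010524000005201000000147000001464000005700051544143508680000014100000140400000150450013f13e4f53c0104ec100000013a000001390000013800000137000099360004d400000001340004cc000264c80000000131400001300004bc150520012e0000012d0000012c12b0000012a4a40000000128127498860104940012448c86000230100000012200000121000480bc00047c9d0000011e0000007c0000011d0004711b0000011a11900000118001171160002c02645400114001131120011104b440000000010f10e0000010d0000010c000000000010b10a000000000010900000108400001070a14180010500104103001020004043910000000000000ff0263f800000000fd0263f000000000fb0263e8000ca00000000000f90003e0000f7000f6000000f54f40000001000010000344f3000000f2000000f1000000f0000000ef0ee3b4860103b0000eb3a8680103a410000000e80e7398e50e438c00000000e20e1000e0000000df0de37486000000dc00009800000000db0003680000036410000000d801035c0008700000000000d6010354000a835086000000d3400000d2000344d00cf00000000000ce0003340000000057000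00041000000cc010168000cb000100ca000bb09c000c902632000000124c701031800000000c50c40000004b30c0008909800031308000c100000000000150c02fc000262f8000bd000100bc000bb0002e800000000b904b2e000000000b70262d8000b500000000000b4400000320262cc000002c839000000b10002c00042600000000000af000000ae0002b48b000000ac09c000000002ac0004b2a800000000a90a829ca601029410000000a4400000a300011ca20a12809f0002789d49c0000000026c00010268000992608601025c0000000096000254100000009400024c1000000092000000910000009001023c100000008e000234150002308b000228684000002601b0002208900000000000880870008641000085000210100000008302620800000000810800007f07e0007d04b0007c07b1e800400000790261e000026000000000007707600000031000000000007547400000000000730001c80047100000070000000000006f06e0001006d000000000006c0001ac000000006a069064680000006702619800000000650000006406300000010188100000006106017c5e0000005d0000005c00016c000101681000000059000160574000005600000055010000000000005440000053052000510000005004f138000000004d010130004000001004b12800000124320101201000011c4600000045000000444430000003110841440000000000003f000000104000003e03d0003c03b0003a400000390380003700000036435000000000d0000000cc320310c0100000002f4000002e02d0002c4000002b02a0a42800000027000000260000002500009023400000220210801f40000000000078000000001d4000001c01b0001a40006400418000174160001501404c00012044100000000f40e0000d00c02c0a00902007000000064050100300000000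

/-- The automaton of the pieces of such words after 8 days. -/
def table8 : ℕ :=
  0x223774000008e8000008e4000000023800000237636000002350000000000234000838000008cc00000002320008c4000005983740000189000002300008bc000000022e22d000bb22c000004000022b0008aa290000022800000227069000100008980000089400224000002237747f1056147f00088800000002211550022000087c00010878000000021d0000021c0000021b00086800000002190000021821785800000618370006f800000002150007d40000000214213000000008480002584400000002100006e07f0000020f0108380020d8300001082c00000828001e26347f0000020900082000607000000000020600074c0002f8140000024e040000020300080800201000000002a000000800001435987f1ff0000000015400000001fe000001fd0006f810108000000007f000000001fb000001fa0007e4000007e000000001bf0107dc00000001f60257d400000001f4000001f31f200000135001f1000001f0000001ef000001ee0fa00010068000bb1ed000001ec00000000001eb000001ea12f001e9000001e8000001e7010798000007940000000155000001e400041c0000000108000001e31e263462000001e10006b8000000008500078000000001df1de7747f1dc76cd2000001da000765d8000001d71d600000000001d50007500001074c001d20000002574400000001d000073c00000738001cd0000001073000000000bb000001cb00072800000724000007200000071c001c600000000714001c400000000001c300021000000001c20002240000070400000001c01bf000550106f810000001bd4100000000056000400001bc000104000106ec000006e837000001b9074000000256e07f0cc4107f000001b70006d800000348100006d4100006d0000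966cc001b252c000006c4101b04107f000001af0256b8001ad00000000001ac400001ab135001aa000001a9000001a800069c00000001a6000001a5000001a400000134131001a3010000bb000001a2000001a1000001a00000019f00067800025674000006719b0000019a00000199000001980000019701065800000001950256500000028410000001930106481000000191000001900000018f18e6346201051c100000018c00062c000006298918861c00000619850000018400060d1218200000135000000000006200000181000600000005fc000000017e0000017d0000017c0000017b0b25e80000000179000095780005dc00000001760005d400000001740005cc0017200000171000000255c0000000016f16e000000000016d16c000bb0005ac000255a80016900000010001650005a0001675987f0000010500059400000590000000016300000162161000101600000000057c3755e00000000574000000015c15b00000000390000000015a00000159410000c2000560100000015740000156000000a31550015401054c000000015200000021000544374000015013153c00010538000005340014c52c7f0005281002552400036000000000014801051c004000014600000145000001441435087f0000014100009400140000000104fc0013e4f4000004f0000000013b0004e8370000013900000138137001361350013400000133132000001310013012f0002a0004b80000024d2d0000012c0104ac000000012a0104a40012849cac0000012600000125124000000000002a123000000ec000000eb000bb0004880012100010120000bb0000011f0000011e02f474000000011c11b00000000348000000011a400000530004651811745862000001150000011400044d1200044400000001100000010f0000010e0000950d0000010c00042c000000010a00042415108000ac08041c00000001061054107f0000003701040c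001024047f0004006200021810000000ff0003f800000000fd00000075000000fc000000fb0fa000f90f8000bb0253dc000f600000010000f50253d000000000f30f2000000f10000004700000000000f00ef00000000000ee400000ed096254000ec000100eb000ea0253a400000000e802539c00000000e6000000e50253900000038c00000000e200038400000000e00df0000001000010000000de000000dd000000dc000000ac0db3687f010364000d835c624000007e00035810000000d50d434cd20d1340000cf000ce000000cd0cc32c7f00032810000000c9010320000c700000000000c600031400010310000000007f000000c3400000c2000000c10c0000000000003b000000bf0002f800000000530000003d000000bd010154000bc000bb0252e800000114b90102e000000000b7000000b60b5000000002d00002f2cc00000000150b22c4000252c000000000af0002b800000000ad0252b0000ab00000000000aa400000a90252a00000029c37000000a60002940042500000000000a4000260a3000000a200028485000000a00930000000027c00047278000000009d0002707f00026c100000009a400000990002609709625462000250004930000000024800010244000000009000023c100000008e000234000000008c0000008b0000008a010224100000008800021c1500021885000210624000002501a000100830002a08200000000000810800007f4100007e0001f4100000007c0251ec000000007a0790007807700076047000750741cc0040000072025000000710000002f000000000007046f000000000006e0001b40046c0000006b000000000006a069000000680000000000067000198000000006506418c6200000061025180000000005f0000005e05d00000010170100000005b05a1645800000057000000560001541000015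053400000520000005101000000000000504000004f04e0004d0000004c04b1280000000049010120004000001004711800000114300101101000010c42000000410000004043f0000002f0f83d43c00000000000104000003b0000003a03900038400000370360003500000034033000000000c8000000c43002f0b8100000002d4000002c02b0002a4000002902809c26000000250000002400008c224000002102007c1e40000000000074000000001c4000001b01a0001940006000417000164000001501404c00012044100000000f40e0000d00c02c0a00902007000000064050100300000000

/-- The automaton of the pieces of such words after 9 days. -/
def table9 : ℕ :=
  0x6a400000001c0000001bf000228001be00000000001bd000001bc000001bb093000b90006e8001b9000000246e000000001b71b6001310006d400000001b4000001b30006c8001b16c000000538350000005407300000000001af000660000006b8000246b400000001ac000001ab000001aa02d6a40002d6a00000069c001526987e000001a51a400000000001a300024da2000001a10006800000067c000240007e19e000000000019d0005c0000001500002d4ac000000019c0000019b0006680040000199024660000000019719600000000001950000019400000193192000001910000000000190000000c00000018f0001480002d638000006340000000132000410000000018c0000018b0000018a000001891013647e18861cd000000186000001850006101400000183000001820242a00000060400000600000245fc000005f80017d0000017c0000017b000000005e8000005e4001780000017700000176000b900000175000001740005cc000005c8000000017116d0005402d5c0004000016f000100000005b8000000016d16c59c000005ac000005a8001693540016859c7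e000598001650000000000164400001631210016200000161000001600000015f0240015e02d000b90000015d02d0015c02456c000000015a0000015902d5600002455c000005582d0000015500000154000001531525447e0000015014f430000005394d0005314b0005280000000149000520000000014702432c000003980000051800000001450000003900051000143000001420000000050400140000000004fc000244f8000004f4000003c8000000013c0ba0000013b000000004e800000001390004e0000004dc0000000136000001350000013440000133132001310004c0000004bc0002d4b8000004b4000004b02d0004ac000000012a0244a47e000090001280000002d49c00126338000004940000000124000001230000003500048835121001200000011f0000011e0240011d02d0002900024d1c0000011b0000011a00000119000000291180000000045c000f70002d116000b9000001150000011402444c00000001120000011111000000000340000000010f0000010e000090140002842d10d4307e0000010b000000620000003b00042909000001080000010700000098000091060000010507f410000000010300032c7e02d408001014007e0003fc0000021c2d000000fe0003f400000000fc000000740fb0000002d1c800000000fa000000f90f8000000f7000200f6000b9000000f50003d0000f30000002d000f20003c4000243c0000ef000000ee0000004700000000000ed0ec00000000254000eb0002d000000b90243a800000000e90243a000000000e70243980000039400000000e400038c00000000e20e10000002d2280002d0002d000000e00df00000000000de000000dd000000dc000000db0da3647e000000d802d35c000d635400400000d400034c2d0d2344d00cf33800000000cd0cc32c7e0003282d0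00000c902d32000000000c70003180002d314000000007e000000c4400000c3000000c20c1000000002dcc0000000bf0002f800000000bd00000052000000bc000000bb02d150000ba000b90242e0000002dcb602d2d400000000b4000000b30002c80003d2c400000000140002c0000242bc00000000ae0002b400000000ac0ab00000000000aa400000a90002a00000029c35000000a60002940042400000000000a4000000a300025c14000000a200028486000280620000009f0930000000027800047274000000009c00026c7e0002682d000000994000009800025c960002546200025000493000000002480002d244000000009000023c2d0000008e0000008d0000008c0000008b02d2282d000000890002200000021c860002147e400000240840002d0830002908200000000000810002000007f0007e42d0007d0001f02d0000007b0241e800000000790780007707600075047000740731c80040000071024000000700000003d000000000006f06e000000001b40046c0000006b000000000006a069000000680000000000067000198000000006506418c620000006102d1800002417c000000005e0000005d05c0000002d16c2d0000005a4000002d0591605700000056000000550001502d00014c52400000510000005002d000004000004f04e0004d0000004c04b128000000004902d1200004711800400000000001144402d10c2d00010841000000400000003f43e0000003d0f03b43a000000000002d400000390000003803700036400000350000003400000033032000000000c4000000c02f02d0b82d0000002c4000002b02a0002940000028027098250000002400000023000088210000002001f0781d000070000000001b4000001a0190001840005c00416000154000001401304800011040000000000f40e0000d00c02c0a0090200700000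0064050100300000000

theorem isNextDay_table0 : isNextDay table0 table1 = true := by decide +kernel

theorem isNextDay_table1 : isNextDay table1 table2 = true := by decide +kernel

theorem isNextDay_table2 : isNextDay table2 table3 = true := by decide +kernel

theorem isNextDay_table3 : isNextDay table3 table4 = true := by decide +kernel

theorem isNextDay_table4 : isNextDay table4 table5 = true := by decide +kernel

theorem isNextDay_table5 : isNextDay table5 table6 = true := by decide +kernel

theorem isNextDay_table6 : isNextDay table6 table7 = true := by decide +kernel

theorem isNextDay_table7 : isNextDay table7 table8 = true := by decide +kernel

theorem isNextDay_table8 : isNextDay table8 table9 = true := by decide +kernel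

/-- After nine days only finitely many pieces are left, all shorter than 60 letters, and 18 further
days are enough for each of them. -/
theorem allAccepted_table9 : allAccepted table9 (decays 18) 60 1 [] = true := by decide +kernel

theorem acceptedDecay_table0 : AcceptedDecay table0 27 :=
  (acceptedDecay_of_allAccepted (by decide +kernel) allAccepted_table9).of_isNextDay isNextDay_table8
    |>.of_isNextDay isNextDay_table7 |>.of_isNextDay isNextDay_table6
    |>.of_isNextDay isNextDay_table5 |>.of_isNextDay isNextDay_table4
    |>.of_isNextDay isNextDay_table3 |>.of_isNextDay isNextDay_table2
    |>.of_isNextDay isNextDay_table1 |>.of_isNextDay isNextDay_table0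

theorem table0_accepts : ∀ s, 1 ≤ s → s ≤ 11 → tableAccepts table0 s = true := by
  intro s h1 h2
  interval_cases s <;> decide +kernel

/-- State `3 * a + l + 3` of `table0` means that the first run consists of `l + 1` letters `a + 1`.
States 1 and 2 mean that nothing, or only the final 4, has been read. -/
theorem table0_step : ∀ a ≤ 2, ∀ s ≤ 11, 1 ≤ s → (∀ l ≤ 2, s ≠ 3 * a + l + 3) → ∀ m ≤ 2,
    (fun s => tableStep table0 s (a + 1))^[m + 1] s = 3 * a + m + 3 := by
  decide +kernel

theorem tableRun_table0 {t : List ℕ} (ht : t = [] ∨ t = [4]) {v : List ℕ}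
    (hv : ∀ a ∈ v, 1 ≤ a ∧ a ≤ 3) (h4 : NoFour v) :
    (v = [] ∧ 1 ≤ tableRun table0 (v ++ t) ∧ tableRun table0 (v ++ t) ≤ 2) ∨
      ∃ a ≤ 2, ∃ l ≤ 2, v.head? = some (a + 1) ∧ tableRun table0 (v ++ t) = 3 * a + l + 3 := by
  induction v using List.runInduction with
  | nil => left; rcases ht with rfl | rfl <;> exact ⟨rfl, by decide +kernel, by decide +kernel⟩
  | append m a v hva ih =>
    right
    obtain ⟨h1, h2⟩ := hv a (by simp)
    obtain ⟨a, rfl⟩ : ∃ b, a = b + 1 := ⟨a - 1, by omega⟩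
    have hm := h4.run_le
    refine ⟨a, by omega, m, by omega, by simp [List.replicate_succ], ?_⟩
    rw [List.append_assoc, tableRun_replicate_append]
    rcases ih (fun b hb => hv b (by simp [hb])) (h4.infix (List.suffix_append _ _).isInfix) with
      ⟨-, g1, g2⟩ | ⟨b, hb, l, hl, hhead, hrun⟩
    · exact table0_step a (by omega) _ (by omega) g1 (fun l _ => by omega) m (by omega)
    · rw [hrun]
      have hab : b ≠ a := by
        rintro rfl
        exact hva hhead
      exact table0_step a (by omega) _ (by omega) (by omega) (fun l _ => by omega) m (by omega)

theorem tableAccepts_table0 {t : List ℕ} (ht : t = [] ∨ t = [4]) {v : List ℕ}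
    (hv : ∀ a ∈ v, 1 ≤ a ∧ a ≤ 3) (h4 : NoFour v) :
    tableAccepts table0 (tableRun table0 (v ++ t)) = true := by
  rcases tableRun_table0 ht hv h4 with ⟨-, h1, h2⟩ | ⟨a, ha, l, hl, -, h⟩
  · exact table0_accepts _ h1 (by omega)
  · exact table0_accepts _ (by omega) (by omega)

/-! ### Strings that are at least two days old -/

theorem noFour_JHC (w : List ℤ) : NoFour (JHC w) := by
  induction w using List.runInduction with
  | nil => intro a h; simp [JHC_nil] at h
  | append m a v hv ih =>
    rw [JHC_replicate_append m.succ_pos hv]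
    refine noFour_cons_cons ih ?_
    rcases v with _ | ⟨b, v⟩
    · exact .inl rfl
    · right
      rcases hr : runs (b :: v) with _ | ⟨⟨k, c⟩, t⟩
      · exact absurd (runs_eq_nil.1 hr) (by simp)
      · refine ⟨k, c, _, by rw [JHC, hr]; rfl, ?_⟩
        rintro rfl
        exact hv (runs_head hr)

theorem NoFour.JHC_head {w : List ℤ} (h : NoFour w) {a : ℤ} (ha : (JHC w).head? = some a) :
    1 ≤ a ∧ a ≤ 3 := by
  induction w using List.runInduction with
  | nil => simp [JHC_nil] at ha
  | append m b v hv _ =>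
    rw [JHC_replicate_append m.succ_pos hv] at ha
    have := h.run_le
    simp only [List.head?_cons, Option.some.injEq] at ha
    omega

/-- From the next day on the first letter is a count, and counts stay at most 3 because `NoFour`
holds every day. -/
theorem NoFour.neverStarts {n : ℤ} (hn : IsExotic n) {w : List ℤ} (h : NoFour w)
    (hw : ∀ a, w.head? = some a → 1 ≤ a ∧ a ≤ 3) : NeverStarts n w := by
  intro k
  have key : NoFour (JHC^[k] w) ∧ ∀ a, (JHC^[k] w).head? = some a → 1 ≤ a ∧ a ≤ 3 := by
    induction k with
    | zero => exact ⟨h, hw⟩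
    | succ k ih =>
      rw [Function.iterate_succ_apply']
      exact ⟨noFour_JHC _, fun a ha => ih.1.JHC_head ha⟩
  intro hk
  obtain ⟨h1, h2⟩ := key.2 n hk
  obtain ⟨g1, g2, g3⟩ := hn
  omega

/-- A string over `1, 2, 3`, starting with one of these letters, except that the last letter may be
any other integer. -/
def IsSegment (s : List ℤ) : Prop :=
  ∃ n v t, IsExotic n ∧ v ≠ [] ∧ (∀ a ∈ v, 1 ≤ a ∧ a ≤ 3) ∧ (t = [] ∨ t = [4]) ∧ s = interp n (v ++ t)

theorem IsSegment.head {s : List ℤ} (h : IsSegment s) {a : ℤ} (ha : s.head? = some a) :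
    1 ≤ a ∧ a ≤ 3 := by
  obtain ⟨n, v, t, -, hv, hv3, -, rfl⟩ := h
  obtain ⟨b, v, rfl⟩ := List.exists_cons_of_ne_nil hv
  obtain ⟨h1, h2⟩ := hv3 b (by simp)
  simp only [interp, List.cons_append, List.map_cons, List.head?_cons, Option.some.injEq,
    letterValue_of_le h2] at ha
  omega

theorem IsSegment.ne_nil {s : List ℤ} (h : IsSegment s) : s ≠ [] := by
  obtain ⟨n, v, t, -, hv, -, -, rfl⟩ := h
  simp [interp, hv]

theorem IsSegment.cons {s : List ℤ} (h : IsSegment s) {a : ℤ} (ha : 1 ≤ a ∧ a ≤ 3) :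
    IsSegment (a :: s) := by
  obtain ⟨n, v, t, hn, -, hv, ht, rfl⟩ := h
  refine ⟨n, a.toNat :: v, t, hn, by simp, fun b hb => ?_, ht, ?_⟩
  · rcases List.mem_cons.1 hb with rfl | hb
    exacts [by omega, hv b hb]
  · simp only [interp, List.cons_append, List.map_cons, letterValue_of_le (show a.toNat ≤ 3 by omega)]
    rw [Int.toNat_of_nonneg (by omega)]

theorem isSegment_singleton {a : ℤ} (ha : 1 ≤ a ∧ a ≤ 3) : IsSegment [a] := by
  refine ⟨0, [a.toNat], [], ⟨by decide, by decide, by decide⟩, by simp, by simp; omega, .inl rfl, ?_⟩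
  simp [interp, letterValue_of_le (show a.toNat ≤ 3 by omega), Int.toNat_of_nonneg (show 0 ≤ a by omega)]

theorem isSegment_pair {a n : ℤ} (ha : 1 ≤ a ∧ a ≤ 3) (hn : IsExotic n) : IsSegment [a, n] := by
  refine ⟨n, [a.toNat], [4], hn, by simp, by simp; omega, .inr rfl, ?_⟩
  simp [interp, letterValue_of_le (show a.toNat ≤ 3 by omega), Int.toNat_of_nonneg (show 0 ≤ a by omega)]
  rfl

/-- The cuts are made behind the exotic letters. Each is the second letter of a pair, so the next
segment starts with a count, which is 1, 2 or 3 by `NoFour x`. -/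
theorem exists_segments {x : List ℤ} (hx : NoFour x) : ∃ ss : List (List ℤ), JHC x = ss.flatten ∧
    (∀ s ∈ ss, IsSegment s) ∧ ss.IsChain fun u v => ∃ a, u.getLast? = some a ∧ NeverStarts a v := by
  induction x using List.runInduction with
  | nil => exact ⟨[], rfl, by simp, .nil⟩
  | append m a v hv ih =>
    have hm := hx.run_le
    have hm' : 1 ≤ ((m + 1 : ℕ) : ℤ) ∧ ((m + 1 : ℕ) : ℤ) ≤ 3 := by omega
    obtain ⟨ss, h1, h2, h3⟩ := ih (hx.infix (List.suffix_append _ _).isInfix)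
    rw [JHC_replicate_append m.succ_pos hv, h1]
    generalize ((m + 1 : ℕ) : ℤ) = k at hm'
    by_cases ha : 1 ≤ a ∧ a ≤ 3
    · cases ss with
      | nil => exact ⟨[[k, a]], rfl, by simpa using (isSegment_singleton ha).cons hm', .singleton _⟩
      | cons s ss =>
        refine ⟨(k :: a :: s) :: ss, rfl, ?_, ?_⟩
        · intro t ht
          rcases List.mem_cons.1 ht with rfl | ht
          · exact ((h2 s (by simp)).cons ha).cons hm'
          · exact h2 t (by simp [ht])
        · obtain ⟨b, s, rfl⟩ := List.exists_cons_of_ne_nil (h2 s (by simp)).ne_nil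
          cases ss with
          | nil => exact .singleton _
          | cons t ss =>
            rw [List.isChain_cons_cons] at h3 ⊢
            exact ⟨by simpa only [List.getLast?_cons_cons] using h3.1, h3.2⟩
    · have hn : IsExotic a := ⟨by rintro rfl; omega, by rintro rfl; omega, by rintro rfl; omega⟩
      refine ⟨[k, a] :: ss, rfl, ?_, ?_⟩
      · intro t ht
        rcases List.mem_cons.1 ht with rfl | ht
        exacts [isSegment_pair hm' hn, h2 t ht]
      · cases ss with
        | nil => exact .singleton _
        | cons s ss =>
          refine List.isChain_cons_cons.2 ⟨⟨a, rfl, ?_⟩, h3⟩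
          have h4 : NoFour s := (noFour_JHC v).infix ⟨[], ss.flatten, by rw [h1]; simp⟩
          exact h4.neverStarts hn fun b hb => (h2 s (by simp)).head hb

theorem NoFour.of_interp {n : ℤ} {w : List ℕ} (h : NoFour (interp n w)) : NoFour w := by
  rintro a ⟨s, t, rfl⟩
  exact h (letterValue n a) ⟨interp n s, interp n t, by simp [interp]⟩

theorem IsSegment.isCompound {s : List ℤ} (h : IsSegment s) (h4 : NoFour s) {m : ℕ} (hm : 27 ≤ m) :
    IsCompound (JHC^[m] s) := by
  obtain ⟨n, v, t, hn, -, hv, ht, rfl⟩ := h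
  have h4 := h4.of_interp
  refine acceptedDecay_table0 n hn (v ++ t) (fun a ha => ?_) h4
    (tableAccepts_table0 ht hv (h4.infix (List.prefix_append _ _).isInfix)) m hm
  rcases List.mem_append.1 ha with ha | ha
  · obtain ⟨h1, h2⟩ := hv a ha
    exact ⟨h1, by omega⟩
  · rcases ht with rfl | rfl
    · simp at ha
    · rw [List.mem_singleton.1 ha]
      exact ⟨by norm_num, le_rfl⟩

/-- The Cosmological Theorem: after 29 days every string is a compound of common and transuranic
elements. -/
theorem mainTheorem1 (w : List ℤ) (hw : w ≠ []) (n : ℕ) (hn : 29 ≤ n) :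
    IsCompound (JHC^[n] w) := by
  -- The first day removes fourfold repetitions; the second puts a count from 1 to 3 before every
  -- letter, which gives segments. The remaining 27 days are those of `acceptedDecay_table0`.
  obtain ⟨n, rfl⟩ : ∃ k, n = k + 2 := ⟨n - 2, by omega⟩
  obtain ⟨ss, h1, h2, h3⟩ := exists_segments (noFour_JHC w)
  rw [Function.iterate_add_apply, show JHC^[2] w = ss.flatten from h1]
  refine (SplitsAs.of_isChain (fun s hs => (h2 s hs).ne_nil) h3).isCompound_iterate fun s hs => ?_
  obtain ⟨l₁, l₂, rfl⟩ := List.append_of_mem hs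
  refine (h2 s hs).isCompound ((noFour_JHC (JHC w)).infix ?_) (by omega)
  exact ⟨l₁.flatten, l₂.flatten, by rw [h1]; simp⟩
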